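/- **Setting.** Let $X\in\mathbb R^{k_X}$, $Y\in\mathbb R^{k_Y}$, $Z\in\mathbb R^{k_Z}$ be random vectors with joint law $P=P_{XYZ}$ such that each coordinate $W_i$ of $(X,Y,Z)$ is discrete, continuous or a discrete–continuous mixture: $\mathbb R=S_d^i\sqcup S_c^i\sqcup S_o^i$ where $S_d^i$ is countable with $P(W_i=x)>0$ for all $x\in S_d^i$; $S_c^i$ is Borel and $P(W_i\in A)=0$ for every Borel Lebesgue-null $A\subseteq S_c^i$; and $P(W_i\in S_o^i)=0$. Put $v^i(A)=u(A\cap S_c^i)+|A\cap S_d^i|$, where $u$ is Lebesgue measure, and let $v$ denote the product of the $v^i$ over the coordinates under consideration. Mutual information is $$I(U;V)=\int\log\frac{dP_{UV}}{d(P_U\otimes P_V)}\,dP_{UV}\in[0,\infty],$$ with $I(U;V)=\infty$ if $P_{UV}\not\ll P_U\otimes P_V$. Assume $I(X;Z)<\infty$ and define $I(X;Y|Z)=I(X;(Y,Z))-I(X;Z)\in(-\infty,\infty]$. **Histograms.** A grid $G$ consists, for each coordinate $i$, of a countable set of one-dimensional bins: single-point bins $\{x\}$ at points $x$ of some subset of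 $S_d^i$, and non-discrete bins, which are pairwise disjoint intervals (with the single-point bins removed from them) of finite width $v^i(B)<\infty$; together the bins cover $S_d^i\cup S_c^i$. Multi-dimensional bins are Cartesian products of one-dimensional bins. Let $v'(G)$ be the largest width $v^i(B)$ of a non-discrete one-dimensional bin $B$, over all coordinates $i$. The discretization $(X_d,Y_d,Z_d)$ records the bin that contains $(X,Y,Z)$. Given data $D_1,\dots,D_n$, the maximum likelihood histogram density $f^h(x,y,z)$ equals $c_j/(n\,v(B_j))$ on the bin $B_j$, where $c_j$ is the number of data points in $B_j$ (and $0$ outside all bins); $f^h(x,z)$, $f^h(y,z)$, $f^h(z)$ are obtained from it by integrating out the other variables with respect to $v$. With $H^h=-\int f^h\log f^h\,dv$ for each of these four densities, let $$I^h(X;Y|Z)=H^h(X,Z)+H^h(Y,Z)-H^h(X,Y,Z)-H^h(Z).$$ **Theorem.** Let $D_1,D_2,\dots$ be i.i.d. with law $P$, and let $I^h_{n,G}$ be the estimator $I^h(X;Y|Z)$ computed from $D_1,\dots,D_n$ with the grid $G$. Let $(G_m)_{m\ge1}$ be any sequence of grids with $v'(G_m)\to0$ such that, for every $m$, the discretization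 of $(X,Y,Z)$ by $G_m$ has finite Shannon entropy (as is automatic for finitely many bins). Then, almost surely, the limit $\lim_{n\to\infty}I^h_{n,G_m}$ exists and is finite for every $m$, and $$\lim_{m\to\infty}\ \lim_{n\to\infty} I^h_{n,G_m}=I(X;Y|Z).$$ -/

import Mathlib

open MeasureTheory ProbabilityTheory Set Filter Topology
open scoped ENNReal

noncomputable section

namespace MixedHist

/-! ### Mixed one-dimensional laws and the reference measure -/

/-- A decomposition `ℝ = Sd ∪ Sc ∪ So` exhibiting the law `μ` of a real random variable as
discrete, continuous, or a discrete-continuous mixture. Here `So` is the complement of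
`Sd ∪ Sc`. -/
structure MixedDecomposition (μ : Measure ℝ) where
  /-- the discrete points -/
  Sd : Set ℝ
  /-- the continuous part -/
  Sc : Set ℝ
  countable_Sd : Sd.Countable
  measurableSet_Sc : MeasurableSet Sc
  disjoint : Disjoint Sd Sc
  pos_of_mem_Sd : ∀ x ∈ Sd, 0 < μ {x}
  null_of_subset_Sc : ∀ A ⊆ Sc, MeasurableSet A → volume A = 0 → μ A = 0
  null_So : μ (Sd ∪ Sc)ᶜ = 0

/-- The reference measure `v(A) = u(A ∩ Sc) + |A ∩ Sd|`, with `u` Lebesgue measure. -/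
def MixedDecomposition.ref {μ : Measure ℝ} (S : MixedDecomposition μ) : Measure ℝ :=
  volume.restrict S.Sc + Measure.count.restrict S.Sd

/-- A random vector is mixed when each of its coordinates is. -/
abbrev VecDecomposition {k : ℕ} (Q : Measure (Fin k → ℝ)) : Type :=
  ∀ i : Fin k, MixedDecomposition (Q.map (fun w => w i))

/-- The product reference measure `v = v¹ × ⋯ × vᵏ`. -/
def VecDecomposition.ref {k : ℕ} {Q : Measure (Fin k → ℝ)} (S : VecDecomposition Q) :
    Measure (Fin k → ℝ) :=
  Measure.pi (fun i => (S i).ref)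

/-! ### Histogram bins -/

/-- One-dimensional bins: countably many single-point bins at discrete points, and countably many
pairwise disjoint intervals from which these points are removed. They cover `Sd ∪ Sc`,
and each interval bin has finite width with respect to `v`. -/
structure Bins {μ : Measure ℝ} (S : MixedDecomposition μ) where
  points : Set ℝ
  intervals : Set (Set ℝ)
  points_subset : points ⊆ S.Sd
  countable_intervals : intervals.Countable
  ordConnected : ∀ I ∈ intervals, I.OrdConnected
  pairwiseDisjoint : intervals.PairwiseDisjoint id
  cover : S.Sd ∪ S.Sc ⊆ points ∪ ⋃₀ intervals
  width_lt_top : ∀ I ∈ intervals, S.ref (I \ points) < ∞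

namespace Bins

variable {μ : Measure ℝ} {S : MixedDecomposition μ}

/-- The single-point bins. -/
def discreteBins (G : Bins S) : Set (Set ℝ) := (fun x => {x}) '' G.points

/-- The non-discrete bins. -/
def intervalBins (G : Bins S) : Set (Set ℝ) := (fun I => I \ G.points) '' G.intervals

/-- All the bins. -/
def bins (G : Bins S) : Set (Set ℝ) := G.intervalBins ∪ G.discreteBins

/-- The bin that contains `x`, or `∅` if there is none. -/
def binOf (G : Bins S) (x : ℝ) : Set ℝ := ⋃₀ {B ∈ G.bins | x ∈ B}

/-- The largest width `v(B)` of a non-discrete bin `B`. -/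
def maxWidth (G : Bins S) : ℝ≥0∞ := ⨆ B ∈ G.intervalBins, S.ref B

end Bins

/-- A multi-dimensional histogram grid: bins for each coordinate. The `k`-dimensional bins are the
products of one-dimensional ones. -/
abbrev VecBins {k : ℕ} {Q : Measure (Fin k → ℝ)} (S : VecDecomposition Q) : Type :=
  ∀ i : Fin k, Bins (S i)

namespace VecBins

variable {k : ℕ} {Q : Measure (Fin k → ℝ)} {S : VecDecomposition Q}

/-- Index type of the `k`-dimensional bins: a one-dimensional bin for each coordinate. -/
abbrev Index (G : VecBins S) : Type := ∀ i : Fin k, (G i).bins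

/-- The `k`-dimensional bin with a given index. -/
def box (G : VecBins S) (j : G.Index) : Set (Fin k → ℝ) :=
  Set.univ.pi (fun i => (j i : Set ℝ))

/-- The `k`-dimensional bin that contains `w`, or `∅` if there is none. -/
def binOf (G : VecBins S) (w : Fin k → ℝ) : Set (Fin k → ℝ) :=
  Set.univ.pi (fun i => (G i).binOf (w i))

/-- The largest width of a non-discrete one-dimensional bin, over all coordinates. -/
def maxWidth (G : VecBins S) : ℝ≥0∞ := ⨆ i, (G i).maxWidth

end VecBins

/-! ### Mutual information -/

/-- Mutual information `∫ log (dP_{XY} / d(P_X P_Y)) dP_{XY}` of a joint law, which is `∞` when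
`P_{XY}` is not absolutely continuous with respect to `P_X P_Y`. -/
def mutualInfo {α β : Type*} [MeasurableSpace α] [MeasurableSpace β]
    (P : Measure (α × β)) : ℝ≥0∞ :=
  InformationTheory.klDiv P ((P.map Prod.fst).prod (P.map Prod.snd))

section Triple

variable {kX kY kZ : ℕ}

/-- The sample space of `(X, Y, Z)`. -/
abbrev Space (kX kY kZ : ℕ) : Type := (Fin kX → ℝ) × (Fin kY → ℝ) × (Fin kZ → ℝ)

/-- `I(X;Z)`. -/
def infoXZ (P : Measure (Space kX kY kZ)) : ℝ≥0∞ :=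
  mutualInfo (P.map (fun w => (w.1, w.2.2)))

/-- `I(X;{Y,Z})`. -/
def infoXYZ (P : Measure (Space kX kY kZ)) : ℝ≥0∞ := mutualInfo P

/-- `I(X;Y|Z) = I(X;{Y,Z}) - I(X;Z)`, used when `I(X;Z) < ∞`. -/
def condMutualInfo (P : Measure (Space kX kY kZ)) : EReal :=
  (infoXYZ P : EReal) - (infoXZ P : EReal)

/-- The vector `(X, Y, Z)` with law `P` is a mixed random vector. -/
structure Mixed (P : Measure (Space kX kY kZ)) where
  x : VecDecomposition (P.map (fun w => w.1))
  y : VecDecomposition (P.map (fun w => w.2.1))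
  z : VecDecomposition (P.map (fun w => w.2.2))

/-- A joint histogram grid for `(X, Y, Z)`. -/
structure Grid {P : Measure (Space kX kY kZ)} (S : Mixed P) where
  x : VecBins S.x
  y : VecBins S.y
  z : VecBins S.z

variable {P : Measure (Space kX kY kZ)}

/-- The joint reference measure on the space of `(X, Y, Z)`. -/
def Mixed.ref (S : Mixed P) : Measure (Space kX kY kZ) := S.x.ref.prod (S.y.ref.prod S.z.ref)

namespace Grid

variable {S : Mixed P} (G : Grid S)

/-- The largest width of a non-discrete bin, over all coordinates of `X`, `Y` and `Z`. -/
def maxWidth : ℝ≥0∞ := max G.x.maxWidth (max G.y.maxWidth G.z.maxWidth)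

/-- The joint bin that contains `w`, or `∅` if there is none. -/
def binOf (w : Space kX kY kZ) : Set (Space kX kY kZ) :=
  G.x.binOf w.1 ×ˢ (G.y.binOf w.2.1 ×ˢ G.z.binOf w.2.2)

/-- The discretization `(X_d, Y_d, Z_d)`, which records the bin of `(X, Y, Z)`, has finite
(Shannon) entropy. -/
def FiniteEntropy : Prop :=
  Summable (fun j : G.x.Index × G.y.Index × G.z.Index =>
    Real.negMulLog (P.real (G.x.box j.1 ×ˢ (G.y.box j.2.1 ×ˢ G.z.box j.2.2))))

/-- The maximum likelihood histogram density of the first `n` data points: on a bin `B` with `c`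
data points it equals `c / (n v(B))`. -/
def density (D : ℕ → Space kX kY kZ) (n : ℕ) (w : Space kX kY kZ) : ℝ :=
  (∑ i ∈ Finset.range n, (G.binOf w).indicator (fun _ => (1 : ℝ)) (D i)) /
    (n * (S.ref (G.binOf w)).toReal)

/-- The histogram density of `(X, Z)`, by marginalization. -/
def densityXZ (D : ℕ → Space kX kY kZ) (n : ℕ) (w : (Fin kX → ℝ) × (Fin kZ → ℝ)) : ℝ :=
  ∫ y, G.density D n (w.1, y, w.2) ∂S.y.ref

/-- The histogram density of `(Y, Z)`, by marginalization. -/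
def densityYZ (D : ℕ → Space kX kY kZ) (n : ℕ) (w : (Fin kY → ℝ) × (Fin kZ → ℝ)) : ℝ :=
  ∫ x, G.density D n (x, w.1, w.2) ∂S.x.ref

/-- The histogram density of `Z`, by marginalization. -/
def densityZ (D : ℕ → Space kX kY kZ) (n : ℕ) (z : Fin kZ → ℝ) : ℝ :=
  ∫ w, G.density D n (w.1, w.2, z) ∂(S.x.ref.prod S.y.ref)

end Grid

/-- The entropy `-∫ f log f dv` of a density `f` with respect to `v`. -/
def entropy {α : Type*} [MeasurableSpace α] (v : Measure α) (f : α → ℝ) : ℝ :=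
  -∫ w, f w * Real.log (f w) ∂v

/-- The histogram estimator
`I^h(X;Y|Z) = H^h(X,Z) + H^h(Y,Z) - H^h(X,Y,Z) - H^h(Z)` from the first `n` data points. -/
def Grid.estimator {S : Mixed P} (G : Grid S) (D : ℕ → Space kX kY kZ) (n : ℕ) : ℝ :=
  entropy (S.x.ref.prod S.z.ref) (G.densityXZ D n)
    + entropy (S.y.ref.prod S.z.ref) (G.densityYZ D n)
    - entropy S.ref (G.density D n)
    - entropy S.z.ref (G.densityZ D n)

end Triple

end MixedHist

end

/-!
For a fixed grid, the bins cut each coordinate into countably many cells, and almost surely every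
data point lies in a bin of positive finite volume. The histogram density is then the average of
the uniform densities on the cells of the data points (`Grid.density_eq_histDensity`). Marginals of
such averages are averages of the same kind, and their differential entropy is the entropy of the
empirical distribution on the cells plus the mean logarithmic cell volume (`entropy_histDensity`).
Volumes of product cells are products, so the volume terms cancel in the estimator, which is
therefore the combination of four plug-in entropies (`Grid.estimator_eq_plugIn`).

The plug-in entropy of a discrete variable of finite entropy is strongly consistent
(`ae_tendsto_plugIn`): it is at most the empirical mean of the information content by Gibbs'
inequality, to which the strong law of large numbers applies, and it is at least any finite partial
sum of `-p̂ log p̂`, which converges to the corresponding partial sum of the entropy. Hence the inner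
limit is `I(X_d; (Y_d, Z_d)) - I(X_d; Z_d)` for the discretized variables.

The outer limit is a convergence statement for mutual information along partitions that need not be
nested. A law is absolutely continuous with respect to its reference measure, and a half-line is a
union of bins except for at most one interval bin, whose probability tends to zero with its width.
So the cells approximate half-lines, and therefore every event, in probability (`Bins.resolves_disc`,
`Resolves.prod`, `resolves_pi`). The Kullback–Leibler divergence is the supremum of
`∫ φ dP - ∫ (exp φ - 1) dQ` over simple functions `φ` (`exists_simpleFunc_lt_dualKL`). Each `φ` agrees
with a function of the cells off a set of small probability, so the divergence is at most the lower
limit of the discretized divergences. The data processing inequality gives the converse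
(`Resolves.tendsto_klDiv`). This covers the case of infinite `I(X; (Y, Z))`, where the joint law may
fail to have a density.
-/

namespace MixedHist

/-! ### Discretizations that resolve every event -/

section Resolves

variable {E α : Type*} [MeasurableSpace E]

/-- The event `A` is approximated, up to sets of small `R`-measure, by events that depend only on
the discretized value `d m`. -/
def Approximable (R : Measure E) (d : ℕ → E → α) (A : Set E) : Prop :=
  ∀ ε : ℝ≥0∞, ε ≠ 0 → ∀ᶠ m in atTop, ∃ T : Set α, R (symmDiff A (d m ⁻¹' T)) ≤ ε

/-- The discretizations `d m` asymptotically resolve all events of the space `(E, R)`. The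
`σ`-algebras they generate need not be nested. -/
def Resolves (R : Measure E) (d : ℕ → E → α) : Prop :=
  ∀ A, MeasurableSet A → Approximable R d A

theorem Approximable.iUnion {R : Measure E} [IsFiniteMeasure R] {d : ℕ → E → α} {A : ℕ → Set E}
    (hA : ∀ k, MeasurableSet (A k)) (h : ∀ k, Approximable R d (A k)) :
    Approximable R d (⋃ k, A k) := by
  intro ε hε
  have htail : Tendsto (fun n => R (⋃ k, A k) - R (accumulate A n)) atTop (𝓝 0) := by
    simpa using ENNReal.Tendsto.sub (tendsto_const_nhds (x := R (⋃ k, A k)))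
      (tendsto_measure_iUnion_accumulate (μ := R) (f := A)) (Or.inl (measure_ne_top R _))
  -- half of `ε` pays for the tail of the union, the other half is shared among its first sets
  obtain ⟨n, hn⟩ := (htail.eventually (gt_mem_nhds (ENNReal.half_pos hε))).exists
  have hacc : MeasurableSet (accumulate A n) := by
    rw [accumulate_def]; exact MeasurableSet.biUnion (to_countable _) fun k _ => hA k
  have hsub : accumulate A n ⊆ ⋃ k, A k := accumulate_subset_iUnion n
  have hδ : ε / 2 / ((n + 1 : ℕ) : ℝ≥0∞) ≠ 0 :=
    (ENNReal.div_pos (ENNReal.half_pos hε).ne' (ENNReal.natCast_ne_top _)).ne'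
  have hev := (eventually_all_finset (Finset.range (n + 1))).2 fun k _ => h k _ hδ
  filter_upwards [hev] with m hm
  choose! T hT using hm
  refine ⟨⋃ k ∈ Finset.range (n + 1), T k, ?_⟩
  have hcover : symmDiff (⋃ k, A k) (d m ⁻¹' ⋃ k ∈ Finset.range (n + 1), T k) ⊆
      ((⋃ k, A k) \ accumulate A n) ∪
        ⋃ k ∈ Finset.range (n + 1), symmDiff (A k) (d m ⁻¹' T k) := by
    intro x hx
    simp only [mem_symmDiff, mem_iUnion, mem_preimage, Finset.mem_range, mem_union, Set.mem_sdiff,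
      mem_accumulate, not_exists, exists_prop, not_and] at hx ⊢
    rcases hx with ⟨⟨k, hk⟩, h2⟩ | ⟨⟨k, hk, hkT⟩, h2⟩
    · by_cases hex : ∃ j ≤ n, x ∈ A j
      · obtain ⟨j, hj, hjA⟩ := hex
        exact Or.inr ⟨j, by omega, Or.inl ⟨hjA, h2 j (by omega)⟩⟩
      · push Not at hex
        exact Or.inl ⟨⟨k, hk⟩, hex⟩
    · exact Or.inr ⟨k, hk, Or.inr ⟨hkT, h2 k⟩⟩
  calc _ ≤ R ((⋃ k, A k) \ accumulate A n) +
        R (⋃ k ∈ Finset.range (n + 1), symmDiff (A k) (d m ⁻¹' T k)) :=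
      (measure_mono hcover).trans (measure_union_le _ _)
    _ ≤ ε / 2 + ∑ k ∈ Finset.range (n + 1), ε / 2 / ((n + 1 : ℕ) : ℝ≥0∞) := by
      refine add_le_add ?_ ((measure_biUnion_finset_le _ _).trans
        (Finset.sum_le_sum fun k hk => hT k hk))
      rw [measure_sdiff hsub hacc.nullMeasurableSet (measure_ne_top _ _)]
      exact hn.le
    _ = ε := by
      rw [Finset.sum_const, Finset.card_range, nsmul_eq_mul,
        ENNReal.mul_div_cancel (by simp) (ENNReal.natCast_ne_top _), ENNReal.add_halves]

/-- The measurable approximable events form a `σ`-algebra. -/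
@[reducible] def approximableSpace (R : Measure E) [IsFiniteMeasure R] (d : ℕ → E → α) :
    MeasurableSpace E where
  MeasurableSet' A := MeasurableSet A ∧ Approximable R d A
  measurableSet_empty := ⟨.empty, fun ε _ => .of_forall fun m => ⟨∅, by simp⟩⟩
  measurableSet_compl A hA := ⟨hA.1.compl, fun ε hε => by
    filter_upwards [hA.2 ε hε] with m ⟨T, hT⟩
    exact ⟨Tᶜ, by rwa [preimage_compl, compl_symmDiff_compl]⟩⟩
  measurableSet_iUnion A hA :=
    ⟨.iUnion fun k => (hA k).1, Approximable.iUnion (fun k => (hA k).1) fun k => (hA k).2⟩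

/-- It is enough to approximate events of a generating family. -/
theorem resolves_of_le {R : Measure E} [IsFiniteMeasure R] {d : ℕ → E → α}
    (h : ‹MeasurableSpace E› ≤ approximableSpace R d) : Resolves R d :=
  fun A hA => (h A hA).2

theorem Resolves.add_self {R : Measure E} {d : ℕ → E → α} (h : Resolves R d) :
    Resolves (R + R) d := by
  intro A hA ε hε
  filter_upwards [h A hA (ε / 2) (ENNReal.half_pos hε).ne'] with m ⟨T, hT⟩
  refine ⟨T, ?_⟩
  rw [Measure.add_apply, ← ENNReal.add_halves ε]
  exact add_le_add hT hT

/-- Events pulled back along `f` are approximable when the discretization `e` determines the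
discretization of `f`. -/
theorem Resolves.approximable_preimage {F β : Type*} [MeasurableSpace F] {R : Measure E}
    {f : E → F} (hf : AEMeasurable f R) {d : ℕ → F → α} {e : ℕ → E → β} {π : β → α}
    (hd : ∀ m, Measurable[_, ⊤] (d m)) (he : ∀ m w, π (e m w) = d m (f w))
    (h : Resolves (R.map f) d) {A : Set F} (hA : MeasurableSet A) :
    Approximable R e (f ⁻¹' A) := by
  intro ε hε
  filter_upwards [h A hA ε hε] with m ⟨T, hT⟩
  refine ⟨π ⁻¹' T, ?_⟩
  have hT' : MeasurableSet (symmDiff A (d m ⁻¹' T)) := hA.symmDiff (hd m trivial)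
  rw [Measure.map_apply_of_aemeasurable hf hT'] at hT
  convert hT using 2
  ext w
  simp [mem_symmDiff, he]

theorem Resolves.prod {F β : Type*} [MeasurableSpace F] {R : Measure (E × F)} [IsFiniteMeasure R]
    {d : ℕ → E → α} {e : ℕ → F → β} (hd : ∀ m, Measurable[_, ⊤] (d m))
    (he : ∀ m, Measurable[_, ⊤] (e m)) (h₁ : Resolves (R.map Prod.fst) d)
    (h₂ : Resolves (R.map Prod.snd) e) :
    Resolves R (fun m w => (d m w.1, e m w.2)) := by
  refine resolves_of_le (sup_le ?_ ?_)
  · rintro _ ⟨A, hA, rfl⟩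
    exact ⟨measurable_fst hA,
      h₁.approximable_preimage measurable_fst.aemeasurable (π := Prod.fst) hd (fun _ _ => rfl) hA⟩
  · rintro _ ⟨A, hA, rfl⟩
    exact ⟨measurable_snd hA,
      h₂.approximable_preimage measurable_snd.aemeasurable (π := Prod.snd) he (fun _ _ => rfl) hA⟩

theorem resolves_pi {ι : Type*} {X : ι → Type*} {β : ι → Type*} [∀ i, MeasurableSpace (X i)]
    {R : Measure (∀ i, X i)} [IsFiniteMeasure R] {d : ∀ i, ℕ → X i → β i}
    (hd : ∀ i m, Measurable[_, ⊤] (d i m)) (h : ∀ i, Resolves (R.map (fun w => w i)) (d i)) :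
    Resolves R (fun m w i => d i m (w i)) := by
  refine resolves_of_le (iSup_le fun i => ?_)
  rintro _ ⟨A, hA, rfl⟩
  exact ⟨measurable_pi_apply i hA, (h i).approximable_preimage (measurable_pi_apply i).aemeasurable
    (π := fun b => b i) (hd i) (fun _ _ => rfl) hA⟩

/-- A simple function agrees with a function of the discretized value off a set of small
measure. -/
theorem Resolves.exists_ne_le {R : Measure E} {d : ℕ → E → α} (h : Resolves R d)
    (φ : SimpleFunc E ℝ) {ε : ℝ≥0∞} (hε : ε ≠ 0) :
    ∀ᶠ m in atTop, ∃ ψ : α → ℝ, R {x | φ x ≠ ψ (d m x)} ≤ ε := by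
  induction φ using SimpleFunc.induction generalizing ε with
  | const c hs =>
    rename_i s
    filter_upwards [h s hs ε hε] with m ⟨T, hT⟩
    refine ⟨T.indicator fun _ => c, (measure_mono fun x hx => ?_).trans hT⟩
    by_contra hcon
    apply hx
    rw [mem_symmDiff] at hcon
    by_cases hxs : x ∈ s <;> by_cases hxT : d m x ∈ T <;> simp_all [Set.indicator]
  | add _ hf hg =>
    filter_upwards [hf (ENNReal.half_pos hε).ne', hg (ENNReal.half_pos hε).ne']
      with m ⟨ψ₁, h₁⟩ ⟨ψ₂, h₂⟩
    refine ⟨ψ₁ + ψ₂, ?_⟩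
    rw [← ENNReal.add_halves ε]
    refine (measure_mono ?_).trans ((measure_union_le _ _).trans (add_le_add h₁ h₂))
    intro x hx
    by_contra hcon
    simp only [mem_union, mem_ofPred_eq, not_or, not_not] at hcon
    exact hx (by simp [hcon.1, hcon.2])

end Resolves

/-! ### Variational formula and lower semicontinuity of the Kullback–Leibler divergence -/

section KL

open InformationTheory

variable {E : Type*} [MeasurableSpace E]

/-- The Donsker–Varadhan type functional, whose supremum over bounded `φ` is the Kullback–Leibler
divergence. -/
noncomputable def dualKL (P Q : Measure E) (φ : E → ℝ) : ℝ :=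
  ∫ x, φ x ∂P - ∫ x, (Real.exp (φ x) - 1) ∂Q

theorem mul_sub_exp_le_klFun {g : ℝ} (hg : 0 ≤ g) (t : ℝ) :
    g * t - (Real.exp t - 1) ≤ klFun g := by
  rw [klFun_apply]
  rcases hg.eq_or_lt with rfl | hg
  · simp [(Real.exp_pos t).le]
  · have h1 : Real.exp t = g * Real.exp (t - Real.log g) := by
      rw [Real.exp_sub, Real.exp_log hg]; field_simp
    have h2 := mul_le_mul_of_nonneg_left (Real.add_one_le_exp (t - Real.log g)) hg.le
    rw [h1]; nlinarith

variable {P Q : Measure E} [IsFiniteMeasure P] [IsFiniteMeasure Q]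

theorem integrable_of_abs_le {R : Measure E} [IsFiniteMeasure R] {φ : E → ℝ} (hφ : Measurable φ)
    {M : ℝ} (hM : ∀ x, |φ x| ≤ M) : Integrable φ R :=
  Integrable.of_bound hφ.aestronglyMeasurable M (.of_forall hM)

theorem integrable_exp_sub_one {R : Measure E} [IsFiniteMeasure R] {φ : E → ℝ} (hφ : Measurable φ)
    {M : ℝ} (hM : ∀ x, |φ x| ≤ M) : Integrable (fun x => Real.exp (φ x) - 1) R := by
  refine Integrable.sub (Integrable.of_bound hφ.exp.aestronglyMeasurable (Real.exp M)
    (.of_forall fun x => ?_)) (integrable_const 1)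
  rw [Real.norm_eq_abs, Real.abs_exp]
  exact Real.exp_le_exp.2 ((le_abs_self _).trans (hM x))

theorem integrable_rnDeriv_mul (hac : P ≪ Q) {φ : E → ℝ} (hφ : Measurable φ)
    {M : ℝ} (hM : ∀ x, |φ x| ≤ M) : Integrable (fun x => (P.rnDeriv Q x).toReal * φ x) Q :=
  (integrable_rnDeriv_smul_iff hac).2 (integrable_of_abs_le hφ hM)

theorem dualKL_eq_integral (hac : P ≪ Q) {φ : E → ℝ} (hφ : Measurable φ)
    {M : ℝ} (hM : ∀ x, |φ x| ≤ M) :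
    dualKL P Q φ = ∫ x, ((P.rnDeriv Q x).toReal * φ x - (Real.exp (φ x) - 1)) ∂Q := by
  rw [integral_sub (integrable_rnDeriv_mul hac hφ hM) (integrable_exp_sub_one hφ hM), dualKL,
    ← integral_rnDeriv_smul hac]
  rfl

theorem ofReal_dualKL_le {φ : E → ℝ} (hφ : Measurable φ) {M : ℝ} (hM : ∀ x, |φ x| ≤ M) :
    ENNReal.ofReal (dualKL P Q φ) ≤ klDiv P Q := by
  by_cases h : P ≪ Q ∧ Integrable (llr P Q) P
  · rw [klDiv_eq_integral_klFun, if_pos h, dualKL_eq_integral h.1 hφ hM]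
    exact ENNReal.ofReal_le_ofReal (integral_mono
      ((integrable_rnDeriv_mul h.1 hφ hM).sub (integrable_exp_sub_one hφ hM))
      ((integrable_klFun_rnDeriv_iff h.1).2 h.2)
      fun x => mul_sub_exp_le_klFun ENNReal.toReal_nonneg _)
  · rw [klDiv_eq_integral_klFun, if_neg h]; exact le_top

/-- `g` truncated to `[exp (-n), exp n]`. -/
noncomputable def expClip (n : ℕ) (g : ℝ) : ℝ :=
  max (Real.exp (-n)) (min g (Real.exp n))

theorem expClip_pos (n : ℕ) (g : ℝ) : 0 < expClip n g :=
  lt_max_of_lt_left (Real.exp_pos _)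

theorem abs_log_expClip_le (n : ℕ) (g : ℝ) : |Real.log (expClip n g)| ≤ n := by
  rw [abs_le, Real.le_log_iff_exp_le (expClip_pos n g), Real.log_le_iff_le_exp (expClip_pos n g)]
  refine ⟨le_max_left _ _, max_le (Real.exp_le_exp.2 ?_) (min_le_right _ _)⟩
  have : (0 : ℝ) ≤ n := n.cast_nonneg
  linarith

theorem tendsto_expClip {g : ℝ} (hg : 0 ≤ g) :
    Tendsto (fun n => expClip n g) atTop (𝓝 g) := by
  have h1 : Tendsto (fun n : ℕ => Real.exp (-(n : ℝ))) atTop (𝓝 0) :=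
    Real.tendsto_exp_neg_atTop_nhds_zero.comp tendsto_natCast_atTop_atTop
  have h2 : Tendsto (fun n : ℕ => min g (Real.exp n)) atTop (𝓝 g) := by
    refine tendsto_const_nhds.congr' ?_
    filter_upwards [(Real.tendsto_exp_atTop.comp
      tendsto_natCast_atTop_atTop).eventually_ge_atTop g] with n hn
    exact (min_eq_left hn).symm
  simpa [expClip, hg] using h1.max h2

theorem nonneg_mul_log_expClip (n : ℕ) {g : ℝ} :
    0 ≤ g * Real.log (expClip n g) - (expClip n g - 1) := by
  have hn : (0 : ℝ) ≤ n := n.cast_nonneg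
  have hk := klFun_nonneg (expClip_pos n g).le
  rw [klFun_apply] at hk
  suffices h : expClip n g * Real.log (expClip n g) ≤ g * Real.log (expClip n g) by linarith
  have ha : Real.exp (-n : ℝ) ≤ 1 := Real.exp_le_one_iff.2 (by linarith)
  have hb : 1 ≤ Real.exp (n : ℝ) := Real.one_le_exp hn
  rcases le_total g (Real.exp (-n : ℝ)) with h | h
  · have : expClip n g = Real.exp (-n) := max_eq_left ((min_le_left _ _).trans h)
    rw [this, Real.log_exp]
    nlinarith
  · rcases le_total g (Real.exp (n : ℝ)) with h' | h'
    · rw [expClip, min_eq_left h', max_eq_right h]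
    · have : expClip n g = Real.exp n := by
        rw [expClip, min_eq_right h', max_eq_right (ha.trans hb)]
      rw [this, Real.log_exp]
      nlinarith

/-- The dual functional evaluated at truncations of the log-likelihood ratio comes
arbitrarily close to the divergence, by Fatou's lemma. -/
theorem exists_lt_dualKL_of_ac (hac : P ≪ Q) {c : ℝ≥0∞} (hc : c < klDiv P Q) :
    ∃ φ : E → ℝ, Measurable φ ∧ (∃ M, ∀ x, |φ x| ≤ M) ∧ c < ENNReal.ofReal (dualKL P Q φ) := by
  set g : E → ℝ := fun x => (P.rnDeriv Q x).toReal with hg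
  have hgm : Measurable g := (Measure.measurable_rnDeriv P Q).ennreal_toReal
  have hφm : ∀ n, Measurable fun x => Real.log (expClip n (g x)) := fun n =>
    Real.measurable_log.comp (measurable_const.max (hgm.min measurable_const))
  set F : ℕ → E → ℝ := fun n x =>
    g x * Real.log (expClip n (g x)) - (Real.exp (Real.log (expClip n (g x))) - 1) with hF
  have hlim : ∀ x, Tendsto (fun n => F n x) atTop (𝓝 (klFun (g x))) := by
    intro x
    have h0 : 0 ≤ g x := ENNReal.toReal_nonneg
    have h1 := tendsto_expClip h0
    have h2 : Tendsto (fun n => g x * Real.log (expClip n (g x))) atTop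
        (𝓝 (g x * Real.log (g x))) := by
      rcases h0.eq_or_lt with h | h
      · simp [← h]
      · exact (h1.log h.ne').const_mul _
    have h3 := h2.sub (h1.sub_const 1)
    rw [klFun_apply]
    convert h3 using 2
    · simp [hF, Real.exp_log (expClip_pos _ _)]
    · ring
  have hFm : ∀ n, Measurable (F n) := fun n =>
    (hgm.mul (hφm n)).sub ((hφm n).exp.sub_const 1)
  have hfatou : klDiv P Q ≤ liminf (fun n => ENNReal.ofReal
      (dualKL P Q fun x => Real.log (expClip n (g x)))) atTop := by
    rw [klDiv_eq_lintegral_klFun_of_ac hac]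
    calc _ = ∫⁻ x, liminf (fun n => ENNReal.ofReal (F n x)) atTop ∂Q := by
          refine lintegral_congr fun x => ?_
          exact ((ENNReal.continuous_ofReal.tendsto _).comp (hlim x)).liminf_eq.symm
      _ ≤ liminf (fun n => ∫⁻ x, ENNReal.ofReal (F n x) ∂Q) atTop :=
          lintegral_liminf_le fun n => (hFm n).ennreal_ofReal
      _ = _ := by
          congr 1
          ext n
          rw [dualKL_eq_integral hac (hφm n) (fun x => abs_log_expClip_le n (g x))]
          refine (ofReal_integral_eq_lintegral_ofReal
            ((integrable_rnDeriv_mul hac (hφm n) (fun x => abs_log_expClip_le n (g x))).sub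
              (integrable_exp_sub_one (hφm n) fun x => abs_log_expClip_le n (g x)))
            (.of_forall fun x => ?_)).symm
          simpa [Real.exp_log (expClip_pos _ _)] using nonneg_mul_log_expClip n (g := g x)
  obtain ⟨n, hn⟩ := (eventually_lt_of_lt_liminf (hc.trans_le hfatou)).exists
  exact ⟨_, hφm n, ⟨n, fun x => abs_log_expClip_le n (g x)⟩, hn⟩

/-- The Kullback–Leibler divergence is the supremum of the dual functional over simple
functions. -/
theorem exists_simpleFunc_lt_dualKL {c : ℝ≥0∞} (hc : c < klDiv P Q) :
    ∃ φ : SimpleFunc E ℝ, c < ENNReal.ofReal (dualKL P Q φ) := by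
  by_cases hac : P ≪ Q
  · obtain ⟨φ, hφ, ⟨M, hM⟩, hlt⟩ := exists_lt_dualKL_of_ac hac hc
    have hφs := hφ.stronglyMeasurable
    rcases isEmpty_or_nonempty E with hE | ⟨⟨x₀⟩⟩
    · exact ⟨0, by convert hlt using 3⟩
    have hM0 : 0 ≤ M := (abs_nonneg _).trans (hM x₀)
    have hb : ∀ n x, |hφs.approxBounded M n x| ≤ M := fun n x =>
      hφs.norm_approxBounded_le hM0 n x
    have hlim : ∀ x, Tendsto (fun n => hφs.approxBounded M n x) atTop (𝓝 (φ x)) :=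
      fun x => hφs.tendsto_approxBounded_of_norm_le (hM x)
    have h1 : Tendsto (fun n => ∫ x, hφs.approxBounded M n x ∂P) atTop (𝓝 (∫ x, φ x ∂P)) :=
      tendsto_integral_of_dominated_convergence (fun _ => M)
        (fun n => (hφs.approxBounded M n).measurable.aestronglyMeasurable) (integrable_const M)
        (fun n => .of_forall (hb n)) (.of_forall hlim)
    have h2 : Tendsto (fun n => ∫ x, (Real.exp (hφs.approxBounded M n x) - 1) ∂Q) atTop
        (𝓝 (∫ x, (Real.exp (φ x) - 1) ∂Q)) := by
      refine tendsto_integral_of_dominated_convergence (fun _ => Real.exp M + 1)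
        (fun n => ((hφs.approxBounded M n).measurable.exp.sub_const 1).aestronglyMeasurable)
        (integrable_const _) (fun n => .of_forall fun x => ?_)
        (.of_forall fun x => ((Real.continuous_exp.tendsto _).comp (hlim x)).sub_const 1)
      refine (norm_sub_le _ _).trans (add_le_add ?_ (by simp))
      rw [Real.norm_eq_abs, Real.abs_exp]
      exact Real.exp_le_exp.2 ((le_abs_self _).trans (hb n x))
    have h3 := (ENNReal.continuous_ofReal.tendsto _).comp (h1.sub h2)
    obtain ⟨n, hn⟩ := (h3.eventually (lt_mem_nhds hlt)).exists
    exact ⟨hφs.approxBounded M n, hn⟩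
  · -- a `Q`-null set charged by `P` makes the dual functional unbounded
    obtain ⟨N, hN, hQN, hPN⟩ : ∃ N, MeasurableSet N ∧ Q N = 0 ∧ P N ≠ 0 := by
      by_contra! hcon
      exact hac (Measure.AbsolutelyContinuous.mk fun s hs h => hcon s hs h)
    have hp : 0 < P.real N := ENNReal.toReal_pos hPN (measure_ne_top _ _)
    have hctop : c ≠ ∞ := (hc.trans_le le_top).ne
    refine ⟨SimpleFunc.piecewise N hN (SimpleFunc.const _ ((c.toReal + 1) / P.real N))
      (SimpleFunc.const _ 0), ?_⟩
    have hval : dualKL P Q (SimpleFunc.piecewise N hN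
        (SimpleFunc.const _ ((c.toReal + 1) / P.real N)) (SimpleFunc.const _ 0)) =
        c.toReal + 1 := by
      have h1 : ∫ x, (Real.exp ((SimpleFunc.piecewise N hN
          (SimpleFunc.const _ ((c.toReal + 1) / P.real N)) (SimpleFunc.const _ 0)) x) - 1) ∂Q
          = 0 := by
        refine integral_eq_zero_of_ae ?_
        filter_upwards [measure_eq_zero_iff_ae_notMem.1 hQN] with x hx
        simp [hx]
      rw [dualKL, h1, sub_zero]
      have h2 : ∀ x, (SimpleFunc.piecewise N hN (SimpleFunc.const _ ((c.toReal + 1) / P.real N))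
          (SimpleFunc.const _ 0)) x = N.indicator (fun _ => (c.toReal + 1) / P.real N) x := by
        intro x; by_cases hx : x ∈ N <;> simp [hx]
      simp_rw [h2]
      rw [integral_indicator hN, setIntegral_const, smul_eq_mul]
      field_simp
    rw [hval, ENNReal.lt_ofReal_iff_toReal_lt hctop]
    linarith

theorem abs_integral_sub_le_of_ne {ρ : Measure E} [IsFiniteMeasure ρ] {φ ψ : E → ℝ}
    (hφ : Integrable φ ρ) (hψ : Integrable ψ ρ) (hφm : Measurable φ) (hψm : Measurable ψ) {C : ℝ}
    (hC : ∀ x, |φ x - ψ x| ≤ C) :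
    |∫ x, φ x ∂ρ - ∫ x, ψ x ∂ρ| ≤ ρ.real {x | φ x ≠ ψ x} * C := by
  have hs : MeasurableSet {x | φ x ≠ ψ x} := (measurableSet_eq_fun hφm hψm).compl
  rw [← integral_sub hφ hψ, ← smul_eq_mul, ← setIntegral_const,
    ← integral_indicator hs]
  refine abs_integral_le_integral_abs.trans (integral_mono (hφ.sub hψ).abs
    ((integrable_const C).indicator hs) fun x => ?_)
  by_cases hx : φ x = ψ x
  · simp [hx]
  · simpa [hx] using hC x

/-- If the discretizations resolve `P + Q`, then the divergences of the discretized laws converge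
to the divergence. -/
theorem Resolves.tendsto_klDiv {α : Type*} [MeasurableSpace α] [DiscreteMeasurableSpace α]
    {d : ℕ → E → α} (hd : ∀ m, Measurable (d m)) (h : Resolves (P + Q) d) :
    Tendsto (fun m => klDiv (P.map (d m)) (Q.map (d m))) atTop (𝓝 (klDiv P Q)) := by
  refine tendsto_of_le_liminf_of_limsup_le ?_ ?_
  · refine le_of_forall_lt fun c hc => ?_
    obtain ⟨c', hcc', hc'⟩ := exists_between hc
    refine hcc'.trans_le (le_liminf_of_le (by isBoundedDefault) ?_)
    obtain ⟨φ, hφ⟩ := exists_simpleFunc_lt_dualKL hc'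
    obtain ⟨M, hM⟩ : ∃ M, ∀ x, |φ x| ≤ M := φ.exists_forall_norm_le
    have hctop : c' ≠ ∞ := (hc'.trans_le le_top).ne
    rw [ENNReal.lt_ofReal_iff_toReal_lt hctop] at hφ
    set K : ℝ := 2 * M + 2 * Real.exp M with hK
    rcases isEmpty_or_nonempty E with hE | ⟨⟨x₀⟩⟩
    · have hP : P = 0 := Measure.eq_zero_of_isEmpty P
      have hQ : Q = 0 := Measure.eq_zero_of_isEmpty Q
      subst hP hQ
      simp only [klDiv_self] at hc'
      exact absurd hc' not_lt_zero
    have hM0 : 0 ≤ M := (abs_nonneg _).trans (hM x₀)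
    have hKpos : 0 < K := by positivity
    have hε : 0 < (dualKL P Q φ - c'.toReal) / K := div_pos (sub_pos.2 hφ) hKpos
    filter_upwards [h.exists_ne_le φ (ENNReal.ofReal_pos.2 hε).ne'] with m ⟨ψ₀, hψ₀⟩
    -- truncation to `[-M, M]` does not destroy agreement with `φ`
    set ψ : α → ℝ := fun a => max (-M) (min (ψ₀ a) M) with hψdef
    have hψM : ∀ a, |ψ a| ≤ M := fun a => abs_le.2
      ⟨le_max_left _ _, max_le (by linarith) (min_le_right _ _)⟩
    have hsub : {x | φ x ≠ ψ (d m x)} ⊆ {x | φ x ≠ ψ₀ (d m x)} := by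
      intro x hx hx'
      apply hx
      obtain ⟨h1, h2⟩ := abs_le.1 (hM x)
      simp only [hψdef, ← hx']
      rw [min_eq_left h2, max_eq_right h1]
    have hψm : Measurable ψ := .of_discrete
    have hψd : Measurable fun x => ψ (d m x) := hψm.comp (hd m)
    have hsmall := (measure_mono hsub).trans hψ₀
    rw [Measure.add_apply] at hsmall
    have hR : P.real {x | φ x ≠ ψ (d m x)} + Q.real {x | φ x ≠ ψ (d m x)} ≤
        (dualKL P Q φ - c'.toReal) / K := by
      rw [measureReal_def, measureReal_def, ← ENNReal.toReal_add (measure_ne_top _ _)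
        (measure_ne_top _ _)]
      exact ENNReal.toReal_le_of_le_ofReal hε.le hsmall
    have hp0 : 0 ≤ P.real {x | φ x ≠ ψ (d m x)} := measureReal_nonneg
    have hq0 : 0 ≤ Q.real {x | φ x ≠ ψ (d m x)} := measureReal_nonneg
    have hA := abs_integral_sub_le_of_ne (ρ := P) (integrable_of_abs_le φ.measurable hM)
      (integrable_of_abs_le hψd fun x => hψM _) φ.measurable hψd (C := 2 * M)
      (fun x => (abs_sub _ _).trans (by linarith [hM x, hψM (d m x)]))
    have hexp : ∀ {t : ℝ}, |t| ≤ M → |Real.exp t| ≤ Real.exp M := fun ht => by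
      rw [Real.abs_exp]; exact Real.exp_le_exp.2 ((le_abs_self _).trans ht)
    have hB := abs_integral_sub_le_of_ne (ρ := Q) (integrable_exp_sub_one φ.measurable hM)
      (integrable_exp_sub_one hψd fun x => hψM _) (φ.measurable.exp.sub_const 1)
      (hψd.exp.sub_const 1) (C := 2 * Real.exp M)
      (fun x => by
        rw [sub_sub_sub_cancel_right]
        exact (abs_sub _ _).trans (by linarith [hexp (hM x), hexp (hψM (d m x))]))
    have hset : {x | Real.exp (φ x) - 1 ≠ Real.exp (ψ (d m x)) - 1} =
        {x | φ x ≠ ψ (d m x)} := by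
      ext x; simp
    rw [hset] at hB
    have hJ : dualKL (P.map (d m)) (Q.map (d m)) ψ =
        ∫ x, ψ (d m x) ∂P - ∫ x, (Real.exp (ψ (d m x)) - 1) ∂Q := by
      rw [dualKL, integral_map (hd m).aemeasurable hψm.aestronglyMeasurable,
        integral_map (hd m).aemeasurable (hψm.exp.sub_const 1).aestronglyMeasurable]
    have hfin : P.real {x | φ x ≠ ψ (d m x)} * (2 * M) +
        Q.real {x | φ x ≠ ψ (d m x)} * (2 * Real.exp M) ≤ dualKL P Q φ - c'.toReal := by
      rw [le_div_iff₀ hKpos] at hR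
      have := Real.exp_pos M
      nlinarith [mul_nonneg hp0 this.le, mul_nonneg hq0 hM0]
    have hJφ : dualKL P Q φ = ∫ x, φ x ∂P - ∫ x, (Real.exp (φ x) - 1) ∂Q := rfl
    have hle : c'.toReal ≤ dualKL (P.map (d m)) (Q.map (d m)) ψ := by
      rw [hJ]
      linarith [(abs_le.1 hA).2, (abs_le.1 hB).1]
    exact ((ENNReal.le_ofReal_iff_toReal_le hctop (ENNReal.toReal_nonneg.trans hle)).2 hle).trans
      (ofReal_dualKL_le hψm hψM)
  · exact limsup_le_of_le (by isBoundedDefault) (.of_forall fun m => klDiv_map_le P Q (hd m))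

end KL


/-! ### Entropy of a discretization -/

section DiscreteEntropy

open InformationTheory

variable {E F α β : Type*} [MeasurableSpace E] [MeasurableSpace F] [MeasurableSpace α]
  [MeasurableSpace β] [DiscreteMeasurableSpace β]

/-- The probability of the cell of the discretization `d` that contains `w`. -/
noncomputable def cellProb (P : Measure E) (d : E → α) (w : E) : ℝ := P.real (d ⁻¹' {d w})

/-- The Shannon entropy of the discretization `d` under `P`. -/
noncomputable def discEntropy (P : Measure E) (d : E → α) : ℝ :=
  -∫ w, Real.log (cellProb P d w) ∂P

theorem absolutelyContinuous_of_singleton [Countable α] {p q : Measure α}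
    (h : ∀ a, q {a} = 0 → p {a} = 0) : p ≪ q := by
  intro s hs
  rw [measure_null_iff_singleton s.to_countable] at hs ⊢
  exact fun a ha => h a (hs a ha)

theorem measurable_cellProb [DiscreteMeasurableSpace α] (P : Measure E) {d : E → α}
    (hd : Measurable d) : Measurable (cellProb P d) :=
  (Measurable.of_discrete (f := fun a : α => P.real (d ⁻¹' {a}))).comp hd

variable [Countable α] [DiscreteMeasurableSpace α] {P : Measure E}

theorem ae_cellProb_pos [IsFiniteMeasure P] {d : E → α} (hd : Measurable d) :
    ∀ᵐ w ∂P, 0 < cellProb P d w := by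
  have h : ∀ᵐ a ∂(P.map d), 0 < P.real (d ⁻¹' {a}) := by
    rw [ae_iff_of_countable]
    intro a ha
    rw [Measure.map_apply hd (.singleton a)] at ha
    exact ENNReal.toReal_pos ha (measure_ne_top _ _)
  exact ae_of_ae_map hd.aemeasurable h

/-- A coarser discretization of a discretization of finite entropy has finite entropy. -/
theorem integrable_log_cellProb_comp [IsProbabilityMeasure P] {d : E → α} (hd : Measurable d) (f : α → β)
    (h : Integrable (fun w => Real.log (cellProb P d w)) P) :
    Integrable (fun w => Real.log (cellProb P (fun w => f (d w)) w)) P := by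
  refine h.mono (measurable_cellProb P (Measurable.of_discrete.comp hd)).log.aestronglyMeasurable ?_
  filter_upwards [ae_cellProb_pos (P := P) hd] with w hw
  have hle : cellProb P d w ≤ cellProb P (fun w => f (d w)) w :=
    measureReal_mono fun x (hx : d x = d w) => congrArg f hx
  have h1 : cellProb P (fun w => f (d w)) w ≤ 1 := measureReal_le_one
  rw [Real.norm_eq_abs, Real.norm_eq_abs, abs_of_nonpos (Real.log_nonpos (hw.le.trans hle) h1),
    abs_of_nonpos (Real.log_nonpos hw.le (hle.trans h1))]
  exact neg_le_neg (Real.log_le_log hw hle)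

theorem llr_ae_eq_log_div {p q : Measure α} [IsFiniteMeasure p] [IsFiniteMeasure q] (hac : p ≪ q) :
    llr p q =ᵐ[p] fun a => Real.log (p.real {a} / q.real {a}) := by
  refine ae_iff_of_countable.2 fun a ha => ?_
  have hq : q {a} ≠ 0 := fun h => ha (hac h)
  have h := Measure.setLIntegral_rnDeriv hac {a}
  rw [lintegral_singleton] at h
  have hq' : q.real {a} ≠ 0 := (ENNReal.toReal_pos hq (measure_ne_top _ _)).ne'
  change llr p q a = Real.log (p.real {a} / q.real {a})
  rw [llr, measureReal_def p, ← h, ENNReal.toReal_mul, ← measureReal_def, mul_div_cancel_right₀ _ hq']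

/-- For a discretization of finite entropy, the mutual information of the discretized pair is
`H(U) + H(V) - H(U, V)`. -/
theorem klDiv_map_prodMap [Countable β] {P : Measure (E × F)} [IsProbabilityMeasure P] {a : E → α} {b : F → β}
    (ha : Measurable a) (hb : Measurable b)
    (hfin : Integrable (fun w => Real.log (cellProb P (fun w => (a w.1, b w.2)) w)) P) :
    ((klDiv (P.map fun w => (a w.1, b w.2))
        (((P.map Prod.fst).prod (P.map Prod.snd)).map fun w => (a w.1, b w.2)) : ℝ≥0∞) : EReal) =
      ((discEntropy P (fun w => a w.1) + discEntropy P (fun w => b w.2) -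
        discEntropy P (fun w => (a w.1, b w.2)) : ℝ) : EReal) := by
  set d : E × F → α × β := fun w => (a w.1, b w.2) with hd
  have hdm : Measurable d := (ha.comp measurable_fst).prodMk (hb.comp measurable_snd)
  set Q := (P.map Prod.fst).prod (P.map Prod.snd) with hQ
  have : IsProbabilityMeasure (P.map Prod.fst) :=
    Measure.isProbabilityMeasure_map measurable_fst.aemeasurable
  have : IsProbabilityMeasure (P.map Prod.snd) :=
    Measure.isProbabilityMeasure_map measurable_snd.aemeasurable
  have : IsProbabilityMeasure (P.map d) := Measure.isProbabilityMeasure_map hdm.aemeasurable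
  have : IsProbabilityMeasure (Q.map d) := Measure.isProbabilityMeasure_map hdm.aemeasurable
  have hp : ∀ c, (P.map d).real {c} = P.real (d ⁻¹' {c}) := fun c =>
    map_measureReal_apply hdm (.singleton c)
  have hq : ∀ c, (Q.map d).real {c} =
      P.real ((fun w => a w.1) ⁻¹' {c.1}) * P.real ((fun w => b w.2) ⁻¹' {c.2}) := by
    intro c
    have hc : d ⁻¹' {c} = (a ⁻¹' {c.1}) ×ˢ (b ⁻¹' {c.2}) := by
      ext w; simp [hd, Prod.ext_iff]
    rw [map_measureReal_apply hdm (.singleton c), hc, hQ, measureReal_prod_prod,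
      map_measureReal_apply measurable_fst (ha (.singleton _)),
      map_measureReal_apply measurable_snd (hb (.singleton _))]
    rfl
  have hac : P.map d ≪ Q.map d := by
    refine absolutelyContinuous_of_singleton fun c hc => ?_
    rw [← measureReal_eq_zero_iff, hq, mul_eq_zero] at hc
    rw [← measureReal_eq_zero_iff, hp]
    rcases hc with hc | hc
    · exact measureReal_mono_null (fun w (hw : d w = c) => congrArg Prod.fst hw) hc
    · exact measureReal_mono_null (fun w (hw : d w = c) => congrArg Prod.snd hw) hc
  have hfst : Integrable (fun w => Real.log (cellProb P (fun w => a w.1) w)) P :=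
    integrable_log_cellProb_comp (P := P) hdm Prod.fst hfin
  have hsnd : Integrable (fun w => Real.log (cellProb P (fun w => b w.2) w)) P :=
    integrable_log_cellProb_comp (P := P) hdm Prod.snd hfin
  have hsum : Integrable (fun w => Real.log (cellProb P (fun w => a w.1) w) +
      Real.log (cellProb P (fun w => b w.2) w)) P := hfst.add hsnd
  have hllr : (fun w => llr (P.map d) (Q.map d) (d w)) =ᵐ[P] fun w =>
      Real.log (cellProb P d w) - (Real.log (cellProb P (fun w => a w.1) w) +
        Real.log (cellProb P (fun w => b w.2) w)) := by
    filter_upwards [ae_of_ae_map hdm.aemeasurable (llr_ae_eq_log_div hac),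
      ae_cellProb_pos (P := P) hdm, ae_cellProb_pos (P := P) (ha.comp measurable_fst),
      ae_cellProb_pos (P := P) (hb.comp measurable_snd)] with w hw h1 h2 h3
    have h2' : cellProb P (fun w => a w.1) w ≠ 0 := h2.ne'
    have h3' : cellProb P (fun w => b w.2) w ≠ 0 := h3.ne'
    rw [hw, hp, hq]
    change Real.log (cellProb P d w / (cellProb P (fun w => a w.1) w *
      cellProb P (fun w => b w.2) w)) = _
    rw [Real.log_div h1.ne' (mul_ne_zero h2' h3'), Real.log_mul h2' h3']
  have hint : Integrable (llr (P.map d) (Q.map d)) (P.map d) := by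
    rw [integrable_map_measure Measurable.of_discrete.aestronglyMeasurable hdm.aemeasurable]
    exact (hfin.sub hsum).congr hllr.symm
  rw [← EReal.coe_ennreal_toReal (klDiv_ne_top hac hint), EReal.coe_eq_coe_iff,
    toReal_klDiv hac hint, integral_map hdm.aemeasurable Measurable.of_discrete.aestronglyMeasurable,
    integral_congr_ae hllr, integral_sub hfin hsum, integral_add hfst hsnd]
  simp only [discEntropy, probReal_univ]
  ring

theorem cellProb_map {f : F → E} {P : Measure F} (hf : Measurable f) {d : E → α}
    (hd : Measurable d) (w : F) :
    cellProb (P.map f) d (f w) = cellProb P (fun w => d (f w)) w :=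
  map_measureReal_apply hf (hd (.singleton _))

theorem integrable_log_cellProb_map {f : F → E} {P : Measure F} (hf : Measurable f) {d : E → α}
    (hd : Measurable d) (h : Integrable (fun w => Real.log (cellProb P (fun w => d (f w)) w)) P) :
    Integrable (fun w => Real.log (cellProb (P.map f) d w)) (P.map f) := by
  rw [integrable_map_measure (measurable_cellProb _ hd).log.aestronglyMeasurable hf.aemeasurable]
  simpa only [Function.comp_def, cellProb_map hf hd] using h

theorem discEntropy_map {f : F → E} {P : Measure F} (hf : Measurable f) {d : E → α}
    (hd : Measurable d) : discEntropy (P.map f) d = discEntropy P fun w => d (f w) := by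
  rw [discEntropy, integral_map hf.aemeasurable
    (measurable_cellProb _ hd).log.aestronglyMeasurable]
  simp only [cellProb_map hf hd, discEntropy]

theorem hasSum_discEntropy {d : E → α} (hd : Measurable d)
    (hfin : Integrable (fun w => Real.log (cellProb P d w)) P) :
    HasSum (fun a => Real.negMulLog (P.real (d ⁻¹' {a}))) (discEntropy P d) := by
  set f : α → ℝ := fun a => -Real.log (P.real (d ⁻¹' {a})) with hf
  have hfm : AEStronglyMeasurable f (P.map d) := Measurable.of_discrete.aestronglyMeasurable
  have hint : Integrable f (P.map d) := by
    rw [integrable_map_measure hfm hd.aemeasurable]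
    exact hfin.neg
  have h := hasSum_integral_iUnion (μ := P.map d) (f := f) (s := fun a : α => {a})
    (fun a => .singleton a) (fun a b hab => by simpa using hab) (by rw [iUnion_of_singleton]; exact hint.integrableOn)
  rw [iUnion_of_singleton, setIntegral_univ, integral_map hd.aemeasurable hfm] at h
  have hterm : ∀ a, ∫ x in {a}, f x ∂(P.map d) = Real.negMulLog (P.real (d ⁻¹' {a})) := by
    intro a
    rw [integral_singleton, map_measureReal_apply hd (.singleton a), hf, smul_eq_mul,
      Real.negMulLog]
    ring
  have htotal : ∫ w, f (d w) ∂P = discEntropy P d := by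
    rw [discEntropy, ← integral_neg]
    rfl
  simpa only [hterm, htotal] using h

end DiscreteEntropy

/-! ### Strong consistency of the plug-in entropy -/

section PlugIn

variable {E α : Type*}

open scoped Classical in
/-- The relative frequency of the value `a` among the first `n` discretized data points. -/
noncomputable def freq (d : E → α) (u : ℕ → E) (n : ℕ) (a : α) : ℝ :=
  (∑ j ∈ Finset.range n, if d (u j) = a then 1 else 0) / n

/-- The entropy of the empirical distribution of the first `n` discretized data points. -/
noncomputable def plugIn (d : E → α) (u : ℕ → E) (n : ℕ) : ℝ :=
  -((∑ i ∈ Finset.range n, Real.log (freq d u n (d (u i)))) / n)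

theorem freq_pos {d : E → α} {u : ℕ → E} {n i : ℕ} (hi : i < n) : 0 < freq d u n (d (u i)) := by
  classical
  refine div_pos (Finset.sum_pos' (fun j _ => by split_ifs <;> simp)
    ⟨i, Finset.mem_range.2 hi, by simp⟩) (by exact_mod_cast Nat.zero_lt_of_lt hi)

theorem freq_nonneg {d : E → α} {u : ℕ → E} {n : ℕ} {a : α} : 0 ≤ freq d u n a :=
  div_nonneg (Finset.sum_nonneg fun j _ => by split_ifs <;> simp) n.cast_nonneg

theorem freq_le_one {d : E → α} {u : ℕ → E} {n : ℕ} {a : α} : freq d u n a ≤ 1 := by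
  refine div_le_one_of_le₀ ?_ n.cast_nonneg
  calc _ ≤ ∑ j ∈ Finset.range n, (1 : ℝ) :=
        Finset.sum_le_sum fun j _ => by split_ifs <;> simp
    _ = n := by simp

/-- The empirical mean of a function of the discretized value, as a sum over values. -/
theorem sum_comp_div_eq_sum_freq [DecidableEq α] (d : E → α) (u : ℕ → E) (n : ℕ) (h : α → ℝ) :
    (∑ i ∈ Finset.range n, h (d (u i))) / n =
      ∑ a ∈ (Finset.range n).image (fun i => d (u i)), freq d u n a * h a := by
  rw [Finset.sum_comp h (fun i => d (u i)), Finset.sum_div]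
  refine Finset.sum_congr rfl fun a _ => ?_
  rw [nsmul_eq_mul, ← Finset.sum_boole, freq, div_mul_eq_mul_div]
  congr!

theorem sum_negMulLog_freq_le_plugIn (d : E → α) (u : ℕ → E) (n : ℕ) (F : Finset α) :
    ∑ a ∈ F, Real.negMulLog (freq d u n a) ≤ plugIn d u n := by
  classical
  set I := (Finset.range n).image (fun i => d (u i)) with hI
  have hzero : ∀ a, a ∉ I → freq d u n a = 0 := by
    intro a ha
    rw [freq, Finset.sum_eq_zero, zero_div]
    intro j hj
    rw [if_neg]
    rintro rfl
    exact ha (Finset.mem_image_of_mem (fun i => d (u i)) hj)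
  have hnn : ∀ a, 0 ≤ Real.negMulLog (freq d u n a) := fun a =>
    Real.negMulLog_nonneg freq_nonneg freq_le_one
  have heq : plugIn d u n = ∑ a ∈ I, Real.negMulLog (freq d u n a) := by
    rw [plugIn, sum_comp_div_eq_sum_freq d u n fun a => Real.log (freq d u n a),
      ← Finset.sum_neg_distrib]
    exact Finset.sum_congr rfl fun a _ => by rw [Real.negMulLog, neg_mul]
  rw [heq]
  calc _ ≤ ∑ a ∈ F ∪ I, Real.negMulLog (freq d u n a) :=
        Finset.sum_le_sum_of_subset_of_nonneg Finset.subset_union_left fun a _ _ => hnn a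
    _ = _ := (Finset.sum_subset Finset.subset_union_right fun a _ ha => by
        rw [hzero a ha, Real.negMulLog_zero]).symm

variable [MeasurableSpace E] [MeasurableSpace α] [Countable α] [DiscreteMeasurableSpace α]

/-- Gibbs' inequality: the empirical entropy is at most the empirical mean of the information
content. -/
theorem plugIn_le {P : Measure E} [IsProbabilityMeasure P] {d : E → α} (hd : Measurable d)
    {u : ℕ → E} (hu : ∀ i, 0 < cellProb P d (u i)) (n : ℕ) :
    plugIn d u n ≤ -((∑ i ∈ Finset.range n, Real.log (cellProb P d (u i))) / n) := by
  classical
  rw [plugIn, neg_le_neg_iff, ← sub_nonpos, ← sub_div, ← Finset.sum_sub_distrib]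
  set h : α → ℝ := fun a => P.real (d ⁻¹' {a}) / freq d u n a - 1 with hh
  have hprob : IsProbabilityMeasure (P.map d) := Measure.isProbabilityMeasure_map hd.aemeasurable
  calc _ ≤ (∑ i ∈ Finset.range n, h (d (u i))) / n := by
        refine div_le_div_of_nonneg_right (Finset.sum_le_sum fun i hi => ?_) n.cast_nonneg
        have hf := freq_pos (d := d) (u := u) (Finset.mem_range.1 hi)
        rw [← Real.log_div (hu i).ne' hf.ne']
        exact Real.log_le_sub_one_of_pos (div_pos (hu i) hf)
    _ = ∑ a ∈ (Finset.range n).image (fun i => d (u i)),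
          (P.real (d ⁻¹' {a}) - freq d u n a) := by
        rw [sum_comp_div_eq_sum_freq]
        refine Finset.sum_congr rfl fun a ha => ?_
        obtain ⟨i, hi, rfl⟩ := Finset.mem_image.1 ha
        have hf := freq_pos (d := d) (u := u) (Finset.mem_range.1 hi)
        rw [hh]
        field_simp
    _ ≤ 0 := by
        rcases Nat.eq_zero_or_pos n with rfl | hn
        · simp
        have hn' : (n : ℝ) ≠ 0 := by exact_mod_cast hn.ne'
        have h1 : ∑ a ∈ (Finset.range n).image (fun i => d (u i)), freq d u n a = 1 := by
          have := sum_comp_div_eq_sum_freq d u n fun _ => (1 : ℝ)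
          simp only [mul_one, Finset.sum_const, Finset.card_range, nsmul_eq_mul] at this
          rw [← this, div_self hn']
        have h2 : ∑ a ∈ (Finset.range n).image (fun i => d (u i)), P.real (d ⁻¹' {a}) ≤ 1 := by
          simp_rw [← map_measureReal_apply hd (MeasurableSet.singleton _)]
          rw [sum_measureReal_singleton]
          exact measureReal_le_one
        rw [Finset.sum_sub_distrib, h1]
        linarith

variable {Ω : Type*} [MeasurableSpace Ω] {ν : Measure Ω}
  {P : Measure E} {D : ℕ → Ω → E}

theorem ae_tendsto_sampleMean (hlaw : ∀ i, HasLaw (D i) P ν) (hindep : iIndepFun D ν) {h : E → ℝ}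
    (hm : Measurable h) (hint : Integrable h P) :
    ∀ᵐ ω ∂ν, Tendsto (fun n : ℕ => (∑ i ∈ Finset.range n, h (D i ω)) / n) atTop
      (𝓝 (∫ w, h w ∂P)) := by
  have hint' : Integrable (h ∘ D 0) ν := by
    rw [← (hlaw 0).map_eq] at hint
    exact (integrable_map_measure hm.aestronglyMeasurable (hlaw 0).aemeasurable).1 hint
  have h1 := strong_law_ae_real (μ := ν) (fun i => h ∘ D i) hint'
    (fun i j hij => (hindep.comp (fun _ => h) fun _ => hm).indepFun hij)
    (fun i => ((hlaw i).identDistrib (hlaw 0)).comp hm)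
  rw [(hlaw 0).integral_comp hm.aestronglyMeasurable] at h1
  exact h1

/-- The empirical entropy of a discretization of finite entropy converges almost surely to its
entropy. -/
theorem ae_tendsto_plugIn [IsProbabilityMeasure P] (hlaw : ∀ i, HasLaw (D i) P ν)
    (hindep : iIndepFun D ν) {d : E → α} (hd : Measurable d)
    (hfin : Integrable (fun w => Real.log (cellProb P d w)) P) :
    ∀ᵐ ω ∂ν, Tendsto (fun n => plugIn d (fun i => D i ω) n) atTop (𝓝 (discEntropy P d)) := by
  classical
  have hfreq : ∀ᵐ ω ∂ν, ∀ a, Tendsto (fun n => freq d (fun i => D i ω) n a) atTop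
      (𝓝 (P.real (d ⁻¹' {a}))) := by
    rw [ae_all_iff]
    intro a
    have hs : MeasurableSet (d ⁻¹' {a}) := hd (.singleton a)
    filter_upwards [ae_tendsto_sampleMean hlaw hindep (h := (d ⁻¹' {a}).indicator fun _ => (1 : ℝ))
      (measurable_const.indicator hs) ((integrable_const _).indicator hs)] with ω hω
    rw [integral_indicator hs, setIntegral_const, smul_eq_mul, mul_one] at hω
    refine hω.congr fun n => ?_
    rw [freq]
    simp only [Set.indicator, mem_preimage, mem_singleton_iff]
  have hpos : ∀ᵐ ω ∂ν, ∀ i, 0 < cellProb P d (D i ω) := by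
    rw [ae_all_iff]
    intro i
    have := ae_cellProb_pos (P := P) hd
    rw [← (hlaw i).map_eq] at this
    have := ae_of_ae_map (hlaw i).aemeasurable this
    rwa [(hlaw i).map_eq] at this
  filter_upwards [hfreq, hpos,
    ae_tendsto_sampleMean hlaw hindep (measurable_cellProb P hd).log hfin] with ω h1 h2 h3
  refine tendsto_order.2 ⟨fun c hc => ?_, fun c hc => ?_⟩
  · obtain ⟨F, hF⟩ := ((hasSum_discEntropy hd hfin).eventually (lt_mem_nhds hc)).exists
    have hlim : Tendsto (fun n => ∑ a ∈ F, Real.negMulLog (freq d (fun i => D i ω) n a)) atTop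
        (𝓝 (∑ a ∈ F, Real.negMulLog (P.real (d ⁻¹' {a})))) :=
      tendsto_finsetSum _ fun a _ => (Real.continuous_negMulLog.tendsto _).comp (h1 a)
    filter_upwards [hlim.eventually (lt_mem_nhds hF)] with n hn
    exact hn.trans_le (sum_negMulLog_freq_le_plugIn _ _ _ _)
  · filter_upwards [h3.neg.eventually (gt_mem_nhds hc)] with n hn
    exact (plugIn_le hd h2 n).trans_lt hn

end PlugIn


/-! ### Histogram densities as averages of cell kernels -/

section Kernel

variable {E F α β : Type*} [MeasurableSpace E] [MeasurableSpace F]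

/-- The `v`-volume of the cell of the discretization `d` that contains `w`. -/
noncomputable def cellVol (v : Measure E) (d : E → α) (w : E) : ℝ := v.real (d ⁻¹' {d w})

/-- The uniform probability density on the cell of `u`, as a function of `w`. -/
noncomputable def cellKernel (v : Measure E) (d : E → α) (u w : E) : ℝ :=
  (d ⁻¹' {d u}).indicator (fun _ => (cellVol v d u)⁻¹) w

/-- The histogram density of the data `u 0, …, u (n - 1)`: the average of the uniform densities on
their cells. -/
noncomputable def histDensity (v : Measure E) (d : E → α) (u : ℕ → E) (n : ℕ) (w : E) : ℝ :=
  (∑ i ∈ Finset.range n, cellKernel v d (u i) w) / n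

theorem cellVol_congr (v : Measure E) {d : E → α} {u w : E} (h : d u = d w) :
    cellVol v d u = cellVol v d w := by rw [cellVol, h, cellVol]

theorem cellVol_prod {v : Measure E} {v' : Measure F} [SFinite v'] (d : E → α) (e : F → β)
    (w : E × F) :
    cellVol (v.prod v') (fun w => (d w.1, e w.2)) w = cellVol v d w.1 * cellVol v' e w.2 := by
  rw [cellVol, cellVol, cellVol, ← measureReal_prod_prod]
  congr 1
  ext x
  simp [Prod.ext_iff]

theorem cellKernel_prod {v : Measure E} {v' : Measure F} [SFinite v'] (d : E → α) (e : F → β)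
    (u w : E × F) :
    cellKernel (v.prod v') (fun w => (d w.1, e w.2)) u w =
      cellKernel v d u.1 w.1 * cellKernel v' e u.2 w.2 := by
  rw [cellKernel, cellVol_prod, cellKernel, cellKernel]
  by_cases h1 : d w.1 = d u.1 <;> by_cases h2 : e w.2 = e u.2 <;>
    simp [Set.indicator, h1, h2, mul_comm]

variable [MeasurableSpace α] [MeasurableSingletonClass α]

theorem integrable_cellKernel {v : Measure E} {d : E → α} (hd : Measurable d) {u : E}
    (hu : 0 < cellVol v d u) : Integrable (cellKernel v d u) v := by
  refine IntegrableOn.integrable_indicator ?_ (hd (.singleton _))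
  exact integrableOn_const (fun h => by simp [cellVol, measureReal_def, h] at hu)

theorem integral_cellKernel {v : Measure E} {d : E → α} (hd : Measurable d) {u : E}
    (hu : 0 < cellVol v d u) : ∫ w, cellKernel v d u w ∂v = 1 := by
  have h : ∫ w, cellKernel v d u w ∂v = cellVol v d u * (cellVol v d u)⁻¹ := by
    simp only [cellKernel]
    rw [integral_indicator (hd (.singleton _)), setIntegral_const, smul_eq_mul]
    rfl
  rw [h, mul_inv_cancel₀ hu.ne']

/-- Integrating a variable out of a product of kernels removes its factor. -/
theorem integral_sum_mul_cellKernel {v : Measure E} {d : E → α} (hd : Measurable d) {u : ℕ → E}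
    (hu : ∀ i, 0 < cellVol v d (u i)) (c : ℕ → ℝ) (n : ℕ) :
    ∫ w, (∑ i ∈ Finset.range n, c i * cellKernel v d (u i) w) / n ∂v =
      (∑ i ∈ Finset.range n, c i) / n := by
  rw [integral_div, integral_finsetSum (Finset.range n) fun i _ =>
    (integrable_cellKernel hd (hu i)).const_mul (c i)]
  congr 1
  simp only [integral_const_mul, fun i => integral_cellKernel hd (hu i), mul_one]

omit [MeasurableSpace α] [MeasurableSingletonClass α] in
theorem histDensity_eq_freq_div (v : Measure E) (d : E → α) (u : ℕ → E) (n : ℕ) (w : E) :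
    histDensity v d u n w = freq d u n (d w) / cellVol v d w := by
  rw [histDensity, freq, div_right_comm]
  congr 1
  rw [Finset.sum_div]
  refine Finset.sum_congr rfl fun i _ => ?_
  by_cases h : d (u i) = d w
  · simp [cellKernel, h, cellVol_congr v h]
  · simp [cellKernel, h, Ne.symm h]

/-- The differential entropy of a histogram density is the plug-in entropy plus the mean
logarithmic volume of the cells of the data points. -/
theorem entropy_histDensity {v : Measure E} {d : E → α} (hd : Measurable d) {u : ℕ → E}
    (hu : ∀ i, 0 < cellVol v d (u i)) (n : ℕ) :
    entropy v (histDensity v d u n) =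
      plugIn d u n + (∑ i ∈ Finset.range n, Real.log (cellVol v d (u i))) / n := by
  have hpt : ∀ w, histDensity v d u n w * Real.log (histDensity v d u n w) =
      (∑ i ∈ Finset.range n,
        Real.log (histDensity v d u n (u i)) * cellKernel v d (u i) w) / n := by
    intro w
    conv_lhs => enter [1]; rw [histDensity]
    rw [div_mul_eq_mul_div, Finset.sum_mul]
    congr 1
    refine Finset.sum_congr rfl fun i _ => ?_
    -- the density is constant on the cell of `u i`, which carries the kernel
    by_cases h : d w = d (u i)
    · rw [mul_comm, histDensity_eq_freq_div, histDensity_eq_freq_div, h, cellVol_congr v h]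
    · simp [cellKernel, h]
  rw [entropy]
  simp_rw [hpt]
  rw [integral_sum_mul_cellKernel hd hu, plugIn, ← neg_div, ← neg_div, ← add_div,
    ← Finset.sum_neg_distrib, ← Finset.sum_neg_distrib, ← Finset.sum_add_distrib]
  congr 1
  refine Finset.sum_congr rfl fun i hi => ?_
  rw [histDensity_eq_freq_div, Real.log_div (freq_pos (Finset.mem_range.1 hi)).ne' (hu i).ne']
  ring

end Kernel


/-! ### Discretization by one-dimensional bins -/

section OneDim

variable {μ : Measure ℝ} {S : MixedDecomposition μ}

instance (S : MixedDecomposition μ) : SigmaFinite S.ref := by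
  have h : SigmaFinite (Measure.count.restrict S.Sd) := by
    refine Measure.sigmaFinite_of_countable
      (S := insert S.Sdᶜ ((fun x => ({x} : Set ℝ)) '' S.Sd))
      ((S.countable_Sd.image _).insert _) ?_ ?_
    · rintro s (rfl | ⟨x, -, rfl⟩)
      · rw [Measure.restrict_apply S.countable_Sd.measurableSet.compl]
        simp
      · exact (Measure.restrict_apply_le _ _).trans_lt (by simp)
    · refine eq_univ_of_forall fun x => ?_
      by_cases hx : x ∈ S.Sd
      · exact ⟨{x}, Or.inr (mem_image_of_mem _ hx), rfl⟩
      · exact ⟨S.Sdᶜ, Or.inl rfl, hx⟩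
  unfold MixedDecomposition.ref
  infer_instance

theorem MixedDecomposition.absolutelyContinuous (S : MixedDecomposition μ) : μ ≪ S.ref := by
  refine Measure.AbsolutelyContinuous.mk fun A hA h => ?_
  rw [MixedDecomposition.ref, Measure.add_apply, add_eq_zero, Measure.restrict_apply hA,
    Measure.restrict_apply hA, Measure.count_eq_zero_iff] at h
  have hsub : A ⊆ (A ∩ S.Sc) ∪ (S.Sd ∪ S.Sc)ᶜ := by
    intro x hx
    have : x ∉ S.Sd := fun hd => (h.2 ▸ (⟨hx, hd⟩ : x ∈ A ∩ S.Sd) : x ∈ (∅ : Set ℝ))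
    by_cases hc : x ∈ S.Sc <;> simp [hx, this, hc]
  exact measure_mono_null hsub (measure_union_null
    (S.null_of_subset_Sc _ inter_subset_right (hA.inter S.measurableSet_Sc) h.1) S.null_So)

theorem MixedDecomposition.ref_singleton_lt_top (S : MixedDecomposition μ) (x : ℝ) :
    S.ref {x} < ∞ := by
  refine (Measure.add_apply _ _ _).trans_lt (ENNReal.add_lt_top.2 ⟨?_, ?_⟩)
  · exact (Measure.restrict_apply_le _ _).trans_lt (by simp)
  · exact (Measure.restrict_apply_le _ _).trans_lt (by simp)

namespace Bins

variable (G : Bins S)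

theorem countable_points : G.points.Countable := S.countable_Sd.mono G.points_subset

theorem countable_bins : G.bins.Countable :=
  (G.countable_intervals.image _).union (G.countable_points.image _)

theorem measurableSet_of_mem_bins {B : Set ℝ} (hB : B ∈ G.bins) : MeasurableSet B := by
  rcases hB with ⟨I, hI, rfl⟩ | ⟨x, -, rfl⟩
  · exact (G.ordConnected I hI).measurableSet.diff G.countable_points.measurableSet
  · exact .singleton x

theorem ref_lt_top_of_mem_bins {B : Set ℝ} (hB : B ∈ G.bins) : S.ref B < ∞ := by
  rcases hB with ⟨I, hI, rfl⟩ | ⟨x, -, rfl⟩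
  · exact G.width_lt_top I hI
  · exact S.ref_singleton_lt_top x

theorem sUnion_bins : ⋃₀ G.bins = G.points ∪ ⋃₀ G.intervals := by
  rw [bins, intervalBins, discreteBins, sUnion_union, sUnion_image, sUnion_image,
    biUnion_of_singleton, union_comm]
  ext x
  by_cases hx : x ∈ G.points <;> simp [hx]

theorem eq_of_mem_of_mem {B C : Set ℝ} (hB : B ∈ G.bins) (hC : C ∈ G.bins) {x : ℝ} (hxB : x ∈ B)
    (hxC : x ∈ C) : B = C := by
  rcases hB with ⟨I, hI, rfl⟩ | ⟨a, ha, rfl⟩ <;> rcases hC with ⟨J, hJ, rfl⟩ | ⟨b, hb, rfl⟩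
  · rw [G.pairwiseDisjoint.elim_set hI hJ x hxB.1 hxC.1]
  · rw [mem_singleton_iff.1 hxC] at hxB
    exact absurd hb hxB.2
  · rw [mem_singleton_iff.1 hxB] at hxC
    exact absurd ha hxC.2
  · rw [← mem_singleton_iff.1 hxB, ← mem_singleton_iff.1 hxC]

variable {G}

theorem binOf_eq {B : Set ℝ} (hB : B ∈ G.bins) {x : ℝ} (hx : x ∈ B) : G.binOf x = B := by
  refine Subset.antisymm (sUnion_subset ?_) (subset_sUnion_of_mem ⟨hB, hx⟩)
  rintro C ⟨hC, hxC⟩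
  exact (G.eq_of_mem_of_mem hC hB hxC hx).le

theorem binOf_eq_of_mem {x y : ℝ} (h : x ∈ G.binOf y) : G.binOf x = G.binOf y := by
  obtain ⟨B, ⟨hB, hyB⟩, hxB⟩ := h
  rw [binOf_eq hB hyB, binOf_eq hB hxB]

theorem binOf_mem {x : ℝ} (hx : x ∈ ⋃₀ G.bins) : G.binOf x ∈ G.bins ∧ x ∈ G.binOf x := by
  obtain ⟨B, hB, hxB⟩ := hx
  rw [binOf_eq hB hxB]
  exact ⟨hB, hxB⟩

theorem binOf_eq_empty {x : ℝ} (hx : x ∉ ⋃₀ G.bins) : G.binOf x = ∅ := by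
  rw [Bins.binOf, sUnion_eq_empty]
  rintro B ⟨hB, hxB⟩
  exact absurd ⟨B, hB, hxB⟩ hx

variable (G)

theorem exists_code : ∃ c : Set ℝ → ℕ, InjOn c (insert ∅ G.bins) :=
  countable_iff_exists_injOn.1 (G.countable_bins.insert ∅)

/-- The discretization of a real variable: an injective numbering of the bins, together with a
number for the points that lie in no bin. -/
noncomputable def disc (x : ℝ) : ℕ := G.exists_code.choose (G.binOf x)

theorem binOf_mem_insert (x : ℝ) : G.binOf x ∈ insert ∅ G.bins := by
  by_cases hx : x ∈ ⋃₀ G.bins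
  · exact Or.inr (binOf_mem hx).1
  · exact Or.inl (binOf_eq_empty hx)

variable {G}

theorem disc_eq_iff {x y : ℝ} : G.disc x = G.disc y ↔ G.binOf x = G.binOf y :=
  G.exists_code.choose_spec.eq_iff (G.binOf_mem_insert x) (G.binOf_mem_insert y)

theorem preimage_disc {x : ℝ} (hx : x ∈ ⋃₀ G.bins) : G.disc ⁻¹' {G.disc x} = G.binOf x := by
  ext y
  rw [mem_preimage, mem_singleton_iff, disc_eq_iff]
  refine ⟨fun h => ?_, binOf_eq_of_mem⟩
  have hx' := binOf_mem hx
  have hy : y ∈ ⋃₀ G.bins := by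
    by_contra hy
    rw [binOf_eq_empty hy] at h
    rw [← h] at hx'
    exact hx'.2
  exact h ▸ (binOf_mem hy).2

variable (G)

theorem measurableSet_sUnion_bins : MeasurableSet (⋃₀ G.bins) :=
  .sUnion G.countable_bins fun _ hB => G.measurableSet_of_mem_bins hB

theorem measurable_disc : Measurable G.disc := by
  refine measurable_to_countable fun x => ?_
  by_cases hx : x ∈ ⋃₀ G.bins
  · rw [preimage_disc hx]
    exact G.measurableSet_of_mem_bins (binOf_mem hx).1
  · have : G.disc ⁻¹' {G.disc x} = (⋃₀ G.bins)ᶜ := by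
      ext y
      rw [mem_preimage, mem_singleton_iff, disc_eq_iff, binOf_eq_empty hx, mem_compl_iff]
      refine ⟨fun h hy => ?_, fun hy => binOf_eq_empty hy⟩
      have := (binOf_mem hy).2
      rw [h] at this
      exact this
    rw [this]
    exact G.measurableSet_sUnion_bins.compl

theorem measure_compl_sUnion_bins : μ (⋃₀ G.bins)ᶜ = 0 := by
  refine measure_mono_null (compl_subset_compl.2 ?_) S.null_So
  rw [G.sUnion_bins]
  exact G.cover

/-- The point `x` lies in a bin of positive width. -/
def Charged (x : ℝ) : Prop := x ∈ ⋃₀ G.bins ∧ S.ref (G.binOf x) ≠ 0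

/-- Bins of zero width have probability zero, because the law is absolutely continuous with respect
to the reference measure. -/
theorem ae_charged : ∀ᵐ x ∂μ, G.Charged x := by
  have h0 : ∀ᵐ x ∂μ, x ∈ ⋃₀ G.bins := G.measure_compl_sUnion_bins
  have h1 : ∀ᵐ x ∂μ, x ∉ ⋃₀ {B ∈ G.bins | S.ref B = 0} := by
    rw [← measure_eq_zero_iff_ae_notMem]
    refine S.absolutelyContinuous ?_
    rw [measure_sUnion_null_iff (G.countable_bins.mono fun _ h => h.1)]
    exact fun B hB => hB.2
  filter_upwards [h0, h1] with x hx hx1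
  exact ⟨hx, fun h => hx1 ⟨_, ⟨(binOf_mem hx).1, h⟩, (binOf_mem hx).2⟩⟩

theorem ref_binOf_ne_top (x : ℝ) : S.ref (G.binOf x) ≠ ∞ := by
  by_cases hx : x ∈ ⋃₀ G.bins
  · exact (G.ref_lt_top_of_mem_bins (binOf_mem hx).1).ne
  · simp [binOf_eq_empty hx]

/-- As the bin width tends to zero, the discretizations resolve every event: a half-line is a union
of bins up to the single interval bin that may straddle its end point. -/
theorem resolves_disc [IsFiniteMeasure μ] {G : ℕ → Bins S}
    (hG : Tendsto (fun m => (G m).maxWidth) atTop (𝓝 0)) :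
    Resolves μ (fun m => (G m).disc) := by
  refine resolves_of_le ((BorelSpace.measurable_eq.trans (borel_eq_generateFrom_Iic ℝ)).le.trans
    (MeasurableSpace.generateFrom_le ?_))
  rintro _ ⟨t, rfl⟩
  refine ⟨measurableSet_Iic, fun ε hε => ?_⟩
  obtain ⟨δ, hδ, hμδ⟩ : ∃ δ > 0, ∀ s, S.ref s < δ → μ s < ε := by
    obtain ⟨δ, hδ, h⟩ := exists_pos_setLIntegral_lt_of_measure_lt (μ := S.ref)
      (f := μ.rnDeriv S.ref) (Measure.lintegral_rnDeriv_lt_top μ S.ref).ne hε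
    refine ⟨δ, hδ, fun s hs => ?_⟩
    rw [← Measure.setLIntegral_rnDeriv S.absolutelyContinuous s]
    exact h s hs
  filter_upwards [hG.eventually (gt_mem_nhds hδ)] with m hm
  refine ⟨(G m).disc '' {x | x ∈ ⋃₀ (G m).bins ∧ (G m).binOf x ⊆ Iic t}, ?_⟩
  set T := {x | x ∈ ⋃₀ (G m).bins ∧ (G m).binOf x ⊆ Iic t} with hT
  -- covered points on which the half-line and its approximation differ share one interval bin
  have hstraddle : ∀ x ∈ ⋃₀ (G m).bins, x ∈ symmDiff (Iic t) ((G m).disc ⁻¹' ((G m).disc '' T)) →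
      ∃ I ∈ (G m).intervals, t ∈ I ∧ x ∈ I \ (G m).points := by
    intro x hx hxs
    obtain ⟨hB, hxB⟩ := binOf_mem hx
    have hiff : x ∈ (G m).disc ⁻¹' ((G m).disc '' T) ↔ (G m).binOf x ⊆ Iic t := by
      constructor
      · rintro ⟨y, hy, hyx⟩
        rw [disc_eq_iff] at hyx
        exact hyx ▸ hy.2
      · exact fun h => ⟨x, ⟨hx, h⟩, rfl⟩
    rw [mem_symmDiff, hiff] at hxs
    rcases hxs with ⟨hxt, hns⟩ | ⟨hs, hxt⟩
    · obtain ⟨y, hy, hyt⟩ := not_subset.1 hns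
      rcases hB with ⟨I, hI, hIB⟩ | ⟨a, -, haB⟩
      · rw [← hIB] at hxB hy
        exact ⟨I, hI, (G m).ordConnected I hI |>.out hxB.1 hy.1 ⟨hxt, (not_le.1 hyt).le⟩, hxB⟩
      · simp only at haB
        rw [← haB, mem_singleton_iff] at hxB hy
        rw [hy, ← hxB] at hyt
        exact absurd hxt hyt
    · exact absurd (hs hxB) hxt
  by_cases hex : ∃ I ∈ (G m).intervals, t ∈ I
  · obtain ⟨I, hI, htI⟩ := hex
    have hsub : symmDiff (Iic t) ((G m).disc ⁻¹' ((G m).disc '' T)) ⊆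
        (⋃₀ (G m).bins)ᶜ ∪ (I \ (G m).points) := by
      intro x hx
      by_cases hxc : x ∈ ⋃₀ (G m).bins
      · obtain ⟨J, hJ, htJ, hxJ⟩ := hstraddle x hxc hx
        rw [(G m).pairwiseDisjoint.elim_set hJ hI t htJ htI] at hxJ
        exact Or.inr hxJ
      · exact Or.inl hxc
    have hw : S.ref (I \ (G m).points) < δ :=
      (le_iSup₂ (f := fun B (_ : B ∈ (G m).intervalBins) => S.ref B) _
        (mem_image_of_mem _ hI)).trans_lt hm
    calc _ ≤ μ (⋃₀ (G m).bins)ᶜ + μ (I \ (G m).points) :=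
          (measure_mono hsub).trans (measure_union_le _ _)
      _ ≤ ε := by rw [measure_compl_sUnion_bins, zero_add]; exact (hμδ _ hw).le
  · have hsub : symmDiff (Iic t) ((G m).disc ⁻¹' ((G m).disc '' T)) ⊆ (⋃₀ (G m).bins)ᶜ := by
      intro x hx hxc
      obtain ⟨I, hI, htI, -⟩ := hstraddle x hxc hx
      exact hex ⟨I, hI, htI⟩
    rw [measure_mono_null hsub (measure_compl_sUnion_bins _)]
    exact zero_le

end Bins

end OneDim


/-! ### Discretization by multi-dimensional bins -/

section Vector

variable {k : ℕ} {Q : Measure (Fin k → ℝ)} {S : VecDecomposition Q}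

instance (S : VecDecomposition Q) : SigmaFinite S.ref := by
  unfold VecDecomposition.ref
  infer_instance

namespace VecBins

variable (G : VecBins S)

/-- The coordinatewise discretization of a vector. -/
noncomputable def disc (w : Fin k → ℝ) : Fin k → ℕ := fun i => (G i).disc (w i)

/-- Every coordinate of `w` lies in a bin of positive width. -/
def Charged (w : Fin k → ℝ) : Prop := ∀ i, (G i).Charged (w i)

theorem measurable_disc : Measurable G.disc :=
  measurable_pi_lambda _ fun i => (G i).measurable_disc.comp (measurable_pi_apply i)

theorem ae_charged : ∀ᵐ w ∂Q, G.Charged w :=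
  ae_all_iff.2 fun i => ae_of_ae_map (measurable_pi_apply i).aemeasurable (G i).ae_charged

variable {G}

theorem preimage_disc {w : Fin k → ℝ} (hw : ∀ i, w i ∈ ⋃₀ (G i).bins) :
    G.disc ⁻¹' {G.disc w} = G.binOf w := by
  ext u
  simp only [mem_preimage, mem_singleton_iff, VecBins.binOf, mem_univ_pi, funext_iff, disc]
  exact forall_congr' fun i => by rw [← Bins.preimage_disc (hw i)]; rfl

theorem binOf_congr {u w : Fin k → ℝ} (h : G.disc u = G.disc w) : G.binOf u = G.binOf w := by
  simp only [VecBins.binOf, fun i => Bins.disc_eq_iff.1 (congrFun h i)]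

theorem disc_eq_of_mem {u w : Fin k → ℝ} (h : u ∈ G.binOf w) : G.disc u = G.disc w :=
  funext fun i => Bins.disc_eq_iff.2 (Bins.binOf_eq_of_mem (h i trivial))

theorem mem_binOf {w : Fin k → ℝ} (hw : ∀ i, w i ∈ ⋃₀ (G i).bins) : w ∈ G.binOf w :=
  fun i _ => (Bins.binOf_mem (hw i)).2

theorem preimage_disc_of_mem_box {w : Fin k → ℝ} {j : G.Index} (hw : w ∈ G.box j) :
    G.disc ⁻¹' {G.disc w} = G.box j := by
  rw [preimage_disc fun i => ⟨_, (j i).2, hw i trivial⟩, VecBins.binOf, VecBins.box]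
  exact congrArg _ (funext fun i => Bins.binOf_eq (j i).2 (hw i trivial))

theorem exists_mem_box {w : Fin k → ℝ} (hw : ∀ i, w i ∈ ⋃₀ (G i).bins) : ∃ j, w ∈ G.box j :=
  ⟨fun i => ⟨_, (Bins.binOf_mem (hw i)).1⟩, mem_binOf hw⟩

theorem cellVol_pos {w : Fin k → ℝ} (hw : G.Charged w) : 0 < cellVol S.ref G.disc w := by
  rw [cellVol, preimage_disc fun i => (hw i).1, measureReal_def, VecBins.binOf,
    VecDecomposition.ref, Measure.pi_pi, ENNReal.toReal_prod]
  exact Finset.prod_pos fun i _ => ENNReal.toReal_pos (hw i).2 ((G i).ref_binOf_ne_top _)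

instance (G : VecBins S) : Countable G.Index := by
  have := fun i => (G i).countable_bins.to_subtype
  infer_instance

variable (G)

theorem measurableSet_box (j : G.Index) : MeasurableSet (G.box j) :=
  .univ_pi fun i => (G i).measurableSet_of_mem_bins (j i).2

variable {G}

theorem resolves_disc [IsFiniteMeasure Q] {G : ℕ → VecBins S}
    (hG : Tendsto (fun m => (G m).maxWidth) atTop (𝓝 0)) :
    Resolves Q (fun m => (G m).disc) := by
  refine resolves_pi (d := fun i m => (G m i).disc)
    (fun i m s _ => (G m i).measurable_disc .of_discrete) fun i => ?_
  have : IsFiniteMeasure (Q.map fun w => w i) := inferInstance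
  exact Bins.resolves_disc (tendsto_of_tendsto_of_tendsto_of_le_of_le tendsto_const_nhds hG
    (fun _ => zero_le) fun m => le_iSup (fun i => (G m i).maxWidth) i)

end VecBins

end Vector

/-! ### Mutual information of resolving discretizations -/

section MutualInfo

variable {E F α β : Type*} [MeasurableSpace E] [MeasurableSpace F]
  [MeasurableSpace α] [Countable α] [DiscreteMeasurableSpace α]
  [MeasurableSpace β] [Countable β] [DiscreteMeasurableSpace β]

/-- If discretizations of finite entropy resolve both marginals, then the mutual informations of
the discretized pairs converge to the mutual information. -/
theorem tendsto_mutualInfo {P : Measure (E × F)} [IsProbabilityMeasure P] {a : ℕ → E → α}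
    {b : ℕ → F → β} (ha : ∀ m, Measurable (a m)) (hb : ∀ m, Measurable (b m))
    (hra : Resolves (P.map Prod.fst) a) (hrb : Resolves (P.map Prod.snd) b)
    (hfin : ∀ m, Integrable (fun w => Real.log (cellProb P (fun w => (a m w.1, b m w.2)) w)) P) :
    Tendsto (fun m => ((discEntropy P (fun w => a m w.1) + discEntropy P (fun w => b m w.2) -
        discEntropy P (fun w => (a m w.1, b m w.2)) : ℝ) : EReal)) atTop
      (𝓝 (mutualInfo P : EReal)) := by
  have : IsProbabilityMeasure (P.map Prod.fst) :=
    Measure.isProbabilityMeasure_map measurable_fst.aemeasurable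
  have : IsProbabilityMeasure (P.map Prod.snd) :=
    Measure.isProbabilityMeasure_map measurable_snd.aemeasurable
  set Q := (P.map Prod.fst).prod (P.map Prod.snd) with hQ
  have h1 : (P + Q).map Prod.fst = P.map Prod.fst + P.map Prod.fst := by
    rw [Measure.map_add _ _ measurable_fst, hQ, Measure.map_fst_prod, measure_univ, one_smul]
  have h2 : (P + Q).map Prod.snd = P.map Prod.snd + P.map Prod.snd := by
    rw [Measure.map_add _ _ measurable_snd, hQ, Measure.map_snd_prod, measure_univ, one_smul]
  have hR : Resolves (P + Q) fun m w => (a m w.1, b m w.2) :=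
    Resolves.prod (fun m s _ => ha m .of_discrete) (fun m s _ => hb m .of_discrete)
      (h1 ▸ hra.add_self) (h2 ▸ hrb.add_self)
  have hlim := hR.tendsto_klDiv fun m =>
    ((ha m).comp measurable_fst).prodMk ((hb m).comp measurable_snd)
  refine ((continuous_coe_ennreal_ereal.tendsto _).comp hlim).congr fun m => ?_
  exact klDiv_map_prodMap (ha m) (hb m) (hfin m)

end MutualInfo

/-! ### The histogram estimator -/

section Estimator

variable {kX kY kZ : ℕ} {P : Measure (Space kX kY kZ)} {S : Mixed P}

namespace Grid

variable (G : Grid S)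

/-- The discretization of `(X, Y, Z)`. -/
noncomputable def disc (w : Space kX kY kZ) : (Fin kX → ℕ) × (Fin kY → ℕ) × (Fin kZ → ℕ) :=
  (G.x.disc w.1, G.y.disc w.2.1, G.z.disc w.2.2)

/-- Every coordinate of `w` lies in a bin of positive width. -/
def Charged (w : Space kX kY kZ) : Prop :=
  G.x.Charged w.1 ∧ G.y.Charged w.2.1 ∧ G.z.Charged w.2.2

theorem measurable_disc : Measurable G.disc :=
  (G.x.measurable_disc.comp measurable_fst).prodMk
    ((G.y.measurable_disc.comp measurable_snd.fst).prodMk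
      (G.z.measurable_disc.comp measurable_snd.snd))

theorem ae_charged : ∀ᵐ w ∂P, G.Charged w :=
  (ae_of_ae_map measurable_fst.aemeasurable G.x.ae_charged).and
    ((ae_of_ae_map measurable_snd.fst.aemeasurable G.y.ae_charged).and
      (ae_of_ae_map measurable_snd.snd.aemeasurable G.z.ae_charged))

variable {G}

theorem Charged.preimage_disc {w : Space kX kY kZ} (hw : G.Charged w) :
    G.disc ⁻¹' {G.disc w} = G.binOf w := by
  rw [Grid.binOf, ← VecBins.preimage_disc fun i => (hw.1 i).1,
    ← VecBins.preimage_disc fun i => (hw.2.1 i).1, ← VecBins.preimage_disc fun i => (hw.2.2 i).1]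
  ext u
  simp [disc, Prod.ext_iff]

theorem Charged.mem_binOf_iff {u : Space kX kY kZ} (hu : G.Charged u) (w : Space kX kY kZ) :
    u ∈ G.binOf w ↔ G.disc u = G.disc w := by
  constructor
  · rintro ⟨h1, h2, h3⟩
    simp only [disc, VecBins.disc_eq_of_mem h1, VecBins.disc_eq_of_mem h2,
      VecBins.disc_eq_of_mem h3]
  · intro h
    simp only [disc, Prod.ext_iff] at h
    rw [Grid.binOf, ← VecBins.binOf_congr h.1, ← VecBins.binOf_congr h.2.1,
      ← VecBins.binOf_congr h.2.2]
    exact ⟨VecBins.mem_binOf fun i => (hu.1 i).1, VecBins.mem_binOf fun i => (hu.2.1 i).1,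
      VecBins.mem_binOf fun i => (hu.2.2 i).1⟩

theorem binOf_congr {u w : Space kX kY kZ} (h : G.disc u = G.disc w) :
    G.binOf u = G.binOf w := by
  simp only [disc, Prod.ext_iff] at h
  rw [Grid.binOf, Grid.binOf, VecBins.binOf_congr h.1, VecBins.binOf_congr h.2.1,
    VecBins.binOf_congr h.2.2]

/-- Finite Shannon entropy of the discretization, as integrability of its information content. -/
theorem FiniteEntropy.integrable_log_cellProb [IsProbabilityMeasure P] (h : G.FiniteEntropy) :
    Integrable (fun w => Real.log (cellProb P G.disc w)) P := by
  refine ⟨(measurable_cellProb P G.measurable_disc).log.aestronglyMeasurable, ?_⟩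
  set box : G.x.Index × G.y.Index × G.z.Index → Set (Space kX kY kZ) := fun j =>
    G.x.box j.1 ×ˢ (G.y.box j.2.1 ×ˢ G.z.box j.2.2) with hbox
  have hmeas : ∀ j, MeasurableSet (box j) := fun j =>
    (G.x.measurableSet_box _).prod ((G.y.measurableSet_box _).prod (G.z.measurableSet_box _))
  have hcell : ∀ j, ∀ w ∈ box j, cellProb P G.disc w = P.real (box j) := by
    rintro j w ⟨h1, h2, h3⟩
    rw [cellProb, hbox]
    simp only
    rw [← VecBins.preimage_disc_of_mem_box h1, ← VecBins.preimage_disc_of_mem_box h2,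
      ← VecBins.preimage_disc_of_mem_box h3]
    congr 1
    ext u
    simp [disc, Prod.ext_iff]
  have hcover : ∀ᵐ w ∂P, w ∈ ⋃ j, box j := by
    filter_upwards [G.ae_charged] with w hw
    obtain ⟨i, hi⟩ := VecBins.exists_mem_box fun i => (hw.1 i).1
    obtain ⟨j, hj⟩ := VecBins.exists_mem_box fun i => (hw.2.1 i).1
    obtain ⟨l, hl⟩ := VecBins.exists_mem_box fun i => (hw.2.2 i).1
    exact mem_iUnion.2 ⟨(i, j, l), hi, hj, hl⟩
  calc ∫⁻ w, ‖Real.log (cellProb P G.disc w)‖ₑ ∂P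
      = ∫⁻ w in ⋃ j, box j, ‖Real.log (cellProb P G.disc w)‖ₑ ∂P := by
        rw [Measure.restrict_eq_self_of_ae_mem hcover]
    _ ≤ ∑' j, ∫⁻ w in box j, ‖Real.log (cellProb P G.disc w)‖ₑ ∂P := lintegral_iUnion_le _ _
    _ = ∑' j, ENNReal.ofReal (Real.negMulLog (P.real (box j))) := by
        refine tsum_congr fun j => ?_
        rw [setLIntegral_congr_fun (g := fun _ => ‖Real.log (P.real (box j))‖ₑ) (hmeas j)
          fun w hw => by simp only [hcell j w hw], setLIntegral_const,
          Real.enorm_eq_ofReal_abs, abs_of_nonpos (Real.log_nonpos measureReal_nonneg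
            measureReal_le_one), ← ofReal_measureReal, ← ENNReal.ofReal_mul' measureReal_nonneg,
          Real.negMulLog]
        congr 1
        ring
    _ < ∞ := h.tsum_ofReal_lt_top

/-- On data in bins of positive width, the maximum likelihood histogram is the average of the
uniform densities on the cells of the data points. -/
theorem density_eq_histDensity {D : ℕ → Space kX kY kZ} (hD : ∀ i, G.Charged (D i)) (n : ℕ)
    (w : Space kX kY kZ) : G.density D n w = histDensity S.ref G.disc D n w := by
  classical
  have hsum : ∑ i ∈ Finset.range n, (G.binOf w).indicator (fun _ => (1 : ℝ)) (D i) =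
      ∑ i ∈ Finset.range n, if G.disc (D i) = G.disc w then 1 else 0 := by
    refine Finset.sum_congr rfl fun i _ => ?_
    simp only [Set.indicator, (hD i).mem_binOf_iff]
  have hfreq : freq G.disc D n (G.disc w) =
      (∑ i ∈ Finset.range n, if G.disc (D i) = G.disc w then 1 else 0) / n := by
    rw [freq]
    congr!
  rw [histDensity_eq_freq_div, density, hsum, hfreq, div_div]
  -- in a cell without data both sides vanish, whatever the volume of the cell
  by_cases hex : ∃ i, G.disc (D i) = G.disc w
  · obtain ⟨i, hi⟩ := hex
    rw [← cellVol_congr _ hi, cellVol, (hD i).preimage_disc, binOf_congr hi, measureReal_def]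
  · push Not at hex
    simp [hex]

theorem cellKernel_disc (S : Mixed P) (G : Grid S) (u w : Space kX kY kZ) :
    cellKernel S.ref G.disc u w = cellKernel S.x.ref G.x.disc u.1 w.1 *
      (cellKernel S.y.ref G.y.disc u.2.1 w.2.1 * cellKernel S.z.ref G.z.disc u.2.2 w.2.2) := by
  rw [← cellKernel_prod (v := S.y.ref) (v' := S.z.ref) G.y.disc G.z.disc u.2 w.2]
  exact cellKernel_prod (v := S.x.ref) (v' := S.y.ref.prod S.z.ref) G.x.disc
    (fun w => (G.y.disc w.1, G.z.disc w.2)) u w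

theorem cellVol_disc (S : Mixed P) (G : Grid S) (w : Space kX kY kZ) :
    cellVol S.ref G.disc w = cellVol S.x.ref G.x.disc w.1 *
      (cellVol S.y.ref G.y.disc w.2.1 * cellVol S.z.ref G.z.disc w.2.2) := by
  rw [← cellVol_prod (v := S.y.ref) (v' := S.z.ref) G.y.disc G.z.disc w.2]
  exact cellVol_prod (v := S.x.ref) (v' := S.y.ref.prod S.z.ref) G.x.disc
    (fun w => (G.y.disc w.1, G.z.disc w.2)) w

section Marginals

variable {D : ℕ → Space kX kY kZ} (hD : ∀ i, G.Charged (D i)) (n : ℕ)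
include hD

theorem densityXZ_eq_histDensity (w : (Fin kX → ℝ) × (Fin kZ → ℝ)) :
    G.densityXZ D n w = histDensity (S.x.ref.prod S.z.ref)
      (fun w => (G.x.disc w.1, G.z.disc w.2)) (fun i => ((D i).1, (D i).2.2)) n w := by
  simp only [densityXZ, density_eq_histDensity hD, histDensity, cellKernel_disc, cellKernel_prod]
  rw [← integral_sum_mul_cellKernel (v := S.y.ref) G.y.measurable_disc (fun i => VecBins.cellVol_pos (hD i).2.1)]
  congr! 4 with y i
  ring

theorem densityYZ_eq_histDensity (w : (Fin kY → ℝ) × (Fin kZ → ℝ)) :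
    G.densityYZ D n w = histDensity (S.y.ref.prod S.z.ref)
      (fun w => (G.y.disc w.1, G.z.disc w.2)) (fun i => (D i).2) n w := by
  simp only [densityYZ, density_eq_histDensity hD, histDensity, cellKernel_disc, cellKernel_prod]
  rw [← integral_sum_mul_cellKernel G.x.measurable_disc (fun i => VecBins.cellVol_pos (hD i).1)]
  congr! 4 with x i
  ring

theorem densityZ_eq_histDensity (z : Fin kZ → ℝ) :
    G.densityZ D n z = histDensity S.z.ref G.z.disc (fun i => (D i).2.2) n z := by
  have hxy : Measurable fun w : (Fin kX → ℝ) × (Fin kY → ℝ) => (G.x.disc w.1, G.y.disc w.2) :=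
    (G.x.measurable_disc.comp measurable_fst).prodMk (G.y.measurable_disc.comp measurable_snd)
  have hpos : ∀ i, 0 < cellVol (S.x.ref.prod S.y.ref) (fun w => (G.x.disc w.1, G.y.disc w.2))
      ((D i).1, (D i).2.1) := fun i => by
    rw [cellVol_prod]
    exact mul_pos (VecBins.cellVol_pos (hD i).1) (VecBins.cellVol_pos (hD i).2.1)
  simp only [densityZ, density_eq_histDensity hD, histDensity, cellKernel_disc]
  rw [← integral_sum_mul_cellKernel hxy hpos]
  congr! 4 with w i
  rw [cellKernel_prod]
  ring

/-- The volumes of the cells cancel in the estimator, which leaves the combination of plug-in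
entropies of the discretized data. -/
theorem estimator_eq_plugIn :
    G.estimator D n = plugIn (fun w => (G.x.disc w.1, G.z.disc w.2.2)) D n +
      plugIn (fun w => (G.y.disc w.2.1, G.z.disc w.2.2)) D n - plugIn G.disc D n -
      plugIn (fun w => G.z.disc w.2.2) D n := by
  have hx : ∀ i, 0 < cellVol S.x.ref G.x.disc (D i).1 := fun i => VecBins.cellVol_pos (hD i).1
  have hy : ∀ i, 0 < cellVol S.y.ref G.y.disc (D i).2.1 := fun i => VecBins.cellVol_pos (hD i).2.1
  have hz : ∀ i, 0 < cellVol S.z.ref G.z.disc (D i).2.2 := fun i => VecBins.cellVol_pos (hD i).2.2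
  have hxz : ∀ i, cellVol (S.x.ref.prod S.z.ref) (fun w => (G.x.disc w.1, G.z.disc w.2))
      ((D i).1, (D i).2.2) = cellVol S.x.ref G.x.disc (D i).1 *
        cellVol S.z.ref G.z.disc (D i).2.2 := fun i => cellVol_prod _ _ _
  have hyz : ∀ i, cellVol (S.y.ref.prod S.z.ref) (fun w => (G.y.disc w.1, G.z.disc w.2))
      (D i).2 = cellVol S.y.ref G.y.disc (D i).2.1 *
        cellVol S.z.ref G.z.disc (D i).2.2 := fun i => cellVol_prod _ _ _
  have mxz : Measurable fun w : (Fin kX → ℝ) × (Fin kZ → ℝ) => (G.x.disc w.1, G.z.disc w.2) :=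
    (G.x.measurable_disc.comp measurable_fst).prodMk (G.z.measurable_disc.comp measurable_snd)
  have myz : Measurable fun w : (Fin kY → ℝ) × (Fin kZ → ℝ) => (G.y.disc w.1, G.z.disc w.2) :=
    (G.y.measurable_disc.comp measurable_fst).prodMk (G.z.measurable_disc.comp measurable_snd)
  have exz : entropy (S.x.ref.prod S.z.ref) (G.densityXZ D n) =
      plugIn (fun w => (G.x.disc w.1, G.z.disc w.2.2)) D n +
        (∑ i ∈ Finset.range n, Real.log (cellVol S.x.ref G.x.disc (D i).1 *
          cellVol S.z.ref G.z.disc (D i).2.2)) / n := by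
    rw [funext (densityXZ_eq_histDensity hD n),
      entropy_histDensity mxz fun i => (mul_pos (hx i) (hz i)).trans_eq (hxz i).symm]
    simp only [hxz]
    rfl
  have eyz : entropy (S.y.ref.prod S.z.ref) (G.densityYZ D n) =
      plugIn (fun w => (G.y.disc w.2.1, G.z.disc w.2.2)) D n +
        (∑ i ∈ Finset.range n, Real.log (cellVol S.y.ref G.y.disc (D i).2.1 *
          cellVol S.z.ref G.z.disc (D i).2.2)) / n := by
    rw [funext (densityYZ_eq_histDensity hD n),
      entropy_histDensity myz fun i => (mul_pos (hy i) (hz i)).trans_eq (hyz i).symm]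
    simp only [hyz]
    rfl
  have exyz : entropy S.ref (G.density D n) = plugIn G.disc D n +
      (∑ i ∈ Finset.range n, Real.log (cellVol S.x.ref G.x.disc (D i).1 *
        (cellVol S.y.ref G.y.disc (D i).2.1 * cellVol S.z.ref G.z.disc (D i).2.2))) / n := by
    rw [funext (density_eq_histDensity hD n), entropy_histDensity G.measurable_disc
      fun i => (mul_pos (hx i) (mul_pos (hy i) (hz i))).trans_eq (cellVol_disc S G (D i)).symm]
    simp only [cellVol_disc]
  have ez : entropy S.z.ref (G.densityZ D n) = plugIn (fun w => G.z.disc w.2.2) D n +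
      (∑ i ∈ Finset.range n, Real.log (cellVol S.z.ref G.z.disc (D i).2.2)) / n := by
    rw [funext (densityZ_eq_histDensity hD n), entropy_histDensity G.z.measurable_disc hz]
    rfl
  rw [estimator, exz, eyz, exyz, ez]
  simp only [fun i => Real.log_mul (hx i).ne' (mul_pos (hy i) (hz i)).ne',
    fun i => Real.log_mul (hx i).ne' (hz i).ne', fun i => Real.log_mul (hy i).ne' (hz i).ne',
    Finset.sum_add_distrib, add_div]
  ring

end Marginals

/-- The conditional mutual information `H(X,Z) + H(Y,Z) - H(X,Y,Z) - H(Z)` of the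
discretization. -/
noncomputable def discInfo (G : Grid S) : ℝ :=
  discEntropy P (fun w => (G.x.disc w.1, G.z.disc w.2.2)) +
    discEntropy P (fun w => (G.y.disc w.2.1, G.z.disc w.2.2)) - discEntropy P G.disc -
    discEntropy P (fun w => G.z.disc w.2.2)

/-- For a fixed grid, the estimator converges almost surely as the sample size grows. -/
theorem ae_tendsto_estimator [IsProbabilityMeasure P] {Ω : Type*} [MeasurableSpace Ω]
    {ν : Measure Ω} {D : ℕ → Ω → Space kX kY kZ} (hlaw : ∀ i, HasLaw (D i) P ν)
    (hindep : iIndepFun D ν) (h : G.FiniteEntropy) :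
    ∀ᵐ ω ∂ν, Tendsto (fun n => G.estimator (fun i => D i ω) n) atTop (𝓝 G.discInfo) := by
  have hint := h.integrable_log_cellProb
  have hx : Measurable fun w : Space kX kY kZ => G.x.disc w.1 :=
    G.x.measurable_disc.comp measurable_fst
  have hy : Measurable fun w : Space kX kY kZ => G.y.disc w.2.1 :=
    G.y.measurable_disc.comp measurable_snd.fst
  have hz : Measurable fun w : Space kX kY kZ => G.z.disc w.2.2 :=
    G.z.measurable_disc.comp measurable_snd.snd
  have hcharged : ∀ᵐ ω ∂ν, ∀ i, G.Charged (D i ω) := ae_all_iff.2 fun i =>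
    ae_of_ae_map (hlaw i).aemeasurable ((hlaw i).map_eq.symm ▸ G.ae_charged)
  filter_upwards [hcharged,
    ae_tendsto_plugIn hlaw hindep (hx.prodMk hz)
      (integrable_log_cellProb_comp G.measurable_disc (fun a => (a.1, a.2.2)) hint),
    ae_tendsto_plugIn hlaw hindep (hy.prodMk hz)
      (integrable_log_cellProb_comp G.measurable_disc Prod.snd hint),
    ae_tendsto_plugIn hlaw hindep G.measurable_disc hint,
    ae_tendsto_plugIn hlaw hindep hz
      (integrable_log_cellProb_comp G.measurable_disc (fun a => a.2.2) hint)] with ω h0 h1 h2 h3 h4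
  simp only [estimator_eq_plugIn h0]
  exact ((h1.add h2).sub h3).sub h4

/-- As the mesh tends to zero, the conditional mutual information of the discretizations converges
to that of `(X, Y, Z)`. -/
theorem tendsto_discInfo [IsProbabilityMeasure P] (hI : infoXZ P ≠ ∞) {G : ℕ → Grid S}
    (hent : ∀ m, (G m).FiniteEntropy)
    (hmesh : Tendsto (fun m => (G m).maxWidth) atTop (𝓝 0)) :
    Tendsto (fun m => ((G m).discInfo : EReal)) atTop (𝓝 (condMutualInfo P)) := by
  have hint := fun m => (hent m).integrable_log_cellProb
  have hsqueeze : ∀ f : ℕ → ℝ≥0∞, (∀ m, f m ≤ (G m).maxWidth) → Tendsto f atTop (𝓝 0) :=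
    fun f hf => tendsto_of_tendsto_of_tendsto_of_le_of_le tendsto_const_nhds hmesh
      (fun _ => zero_le) hf
  have hrx : Resolves (P.map fun w => w.1) fun m => (G m).x.disc :=
    VecBins.resolves_disc (hsqueeze _ fun m => le_max_left _ _)
  have hry : Resolves (P.map fun w => w.2.1) fun m => (G m).y.disc :=
    VecBins.resolves_disc (hsqueeze _ fun m => (le_max_left _ _).trans (le_max_right _ _))
  have hrz : Resolves (P.map fun w => w.2.2) fun m => (G m).z.disc :=
    VecBins.resolves_disc (hsqueeze _ fun m => (le_max_right _ _).trans (le_max_right _ _))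
  have hryz : Resolves (P.map Prod.snd) fun m w => ((G m).y.disc w.1, (G m).z.disc w.2) := by
    refine Resolves.prod (fun m s _ => (G m).y.measurable_disc .of_discrete)
      (fun m s _ => (G m).z.measurable_disc .of_discrete) ?_ ?_
    · rwa [Measure.map_map measurable_fst measurable_snd]
    · rwa [Measure.map_map measurable_snd measurable_snd]
  have h1 := tendsto_mutualInfo (P := P) (fun m => (G m).x.measurable_disc)
    (fun m => ((G m).y.measurable_disc.comp measurable_fst).prodMk
      ((G m).z.measurable_disc.comp measurable_snd)) hrx hryz hint
  have hf : Measurable fun w : Space kX kY kZ => (w.1, w.2.2) :=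
    measurable_fst.prodMk measurable_snd.snd
  have hprob : IsProbabilityMeasure (P.map fun w => (w.1, w.2.2)) :=
    Measure.isProbabilityMeasure_map hf.aemeasurable
  have hdm : ∀ m, Measurable fun w : (Fin kX → ℝ) × (Fin kZ → ℝ) =>
      ((G m).x.disc w.1, (G m).z.disc w.2) := fun m =>
    ((G m).x.measurable_disc.comp measurable_fst).prodMk
      ((G m).z.measurable_disc.comp measurable_snd)
  have h2 := tendsto_mutualInfo (P := P.map fun w => (w.1, w.2.2))
    (fun m => (G m).x.measurable_disc) (fun m => (G m).z.measurable_disc)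
    (by rwa [Measure.map_map measurable_fst hf]) (by rwa [Measure.map_map measurable_snd hf])
    (fun m => integrable_log_cellProb_map hf (hdm m)
      (integrable_log_cellProb_comp (G m).measurable_disc (fun a => (a.1, a.2.2)) (hint m)))
  have hneg : Tendsto (fun x : EReal => -x) (𝓝 (infoXZ P : EReal)) (𝓝 (-(infoXZ P : EReal))) :=
    continuous_neg.tendsto _
  have hadd := (EReal.continuousAt_add (p := ((infoXYZ P : EReal), -(infoXZ P : EReal)))
    (Or.inr (by simpa [EReal.neg_eq_bot_iff] using hI)) (Or.inl (EReal.coe_ennreal_ne_bot _))).tendsto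
  have hlim := hadd.comp (h1.prodMk_nhds (hneg.comp h2))
  refine hlim.congr fun m => ?_
  have ex : discEntropy (P.map fun w => (w.1, w.2.2)) (fun w => (G m).x.disc w.1) =
      discEntropy P fun w => (G m).x.disc w.1 :=
    discEntropy_map hf ((G m).x.measurable_disc.comp measurable_fst)
  have ez : discEntropy (P.map fun w => (w.1, w.2.2)) (fun w => (G m).z.disc w.2) =
      discEntropy P fun w => (G m).z.disc w.2.2 :=
    discEntropy_map hf ((G m).z.measurable_disc.comp measurable_snd)
  simp only [Function.comp_apply]
  rw [← EReal.coe_neg, ← EReal.coe_add, EReal.coe_eq_coe_iff, discInfo, ex, ez,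
    discEntropy_map hf (hdm m)]
  change _ + discEntropy P (fun w => ((G m).y.disc w.2.1, (G m).z.disc w.2.2)) -
    discEntropy P (G m).disc + _ = _
  ring

end Grid

end Estimator

end MixedHist

theorem mainTheorem1 {kX kY kZ : ℕ}
    (P : Measure (MixedHist.Space kX kY kZ)) [IsProbabilityMeasure P]
    (S : MixedHist.Mixed P)
    (hI : MixedHist.infoXZ P ≠ ∞)
    {Ω : Type*} [MeasurableSpace Ω] (ν : Measure Ω) [IsProbabilityMeasure ν]
    (D : ℕ → Ω → MixedHist.Space kX kY kZ)
    (hlaw : ∀ i, HasLaw (D i) P ν) (hindep : iIndepFun D ν)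
    (G : ℕ → MixedHist.Grid S)
    (hent : ∀ m, (G m).FiniteEntropy)
    (hmesh : Tendsto (fun m => (G m).maxWidth) atTop (𝓝 0)) :
    ∀ᵐ ω ∂ν, ∃ L : ℕ → ℝ,
      (∀ m, Tendsto (fun n => (G m).estimator (fun i => D i ω) n) atTop (𝓝 (L m))) ∧
        Tendsto (fun m => (L m : EReal)) atTop (𝓝 (MixedHist.condMutualInfo P)) := by
  have h : ∀ᵐ ω ∂ν, ∀ m, Tendsto (fun n => (G m).estimator (fun i => D i ω) n) atTop
      (𝓝 (G m).discInfo) :=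
    ae_all_iff.2 fun m => MixedHist.Grid.ae_tendsto_estimator hlaw hindep (hent m)
  filter_upwards [h] with ω hω
  exact ⟨fun m => (G m).discInfo, hω, MixedHist.Grid.tendsto_discInfo hI hent hmesh⟩
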